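/- For $0<a<1$, $0<c<1$ let $\zeta(s,a,c)$ denote the Lerch zeta function, i.e. the analytic continuation to all $s\in\mathbb{C}$ of $\sum_{n\ge 0}e^{2\pi i n a}(n+c)^{-s}$ ($\Re(s)>1$). For real $a,c$ let $\zeta_*(s,a,c)$ denote the extended Lerch zeta function, i.e. the meromorphic continuation in $s$ of $\sum_{n\in\mathbb{Z},\,n+c>0}e^{2\pi i n a}(n+c)^{-s}$ ($\Re(s)>1$). Let $\Box^\circ=(0,1)\times(0,1)$, and let $\partial\Box$ be the boundary of the unit square. For fixed $s\in\mathbb{C}$ let $E(s)$ be the set of those points $(a,c)\in\partial\Box$ for which one of the following holds: (i) $a=0$, $0<c<1$ and $\Re(s)>1$; (ii) $a=1$, $0<c<1$ and $\Re(s)>1$; (iii) $c=0$, $0<a<1$ and $\Re(s)<0$; (iv) $c=1$, $0<a<1$ ($s$ arbitrary); (v) $(a,c)=(0,1)$ or $(a,c)=(1,1)$, and $\Re(s)>1$. Let $X(0)=\{(a,0):0<a<1\}$, and $X(s)=\emptyset$ for $s\ne 0$. **Theorem (Continuous Extension to Boundary).** Let $s\in\mathbb{C}$ and $T\subseteq\partial\Box$.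 Call $g:\Box^\circ\cup T\to\mathbb{C}$ a continuous extension of $\zeta(s,\cdot,\cdot)$ to $T$ if $g$ is continuous and $g(a,c)=\zeta(s,a,c)$ on $\Box^\circ$. Then: 1. A continuous extension of $\zeta(s,\cdot,\cdot)$ to $T$ exists if and only if $T\subseteq E(s)\cup X(s)$. In particular, apart from the edge $c=0$, $0<a<1$ for $s=0$, there is no continuous extension to any boundary point outside the cases (i)–(v). 2. Every continuous extension $g$ to $T$ satisfies $g(a,c)=\zeta_*(s,a,c)$ at all points of $T\cap E(s)$. At points of $T\cap X(s)$ (so $s=0$, $c=0$, $0<a<1$) it satisfies $g(a,0)=\zeta_*(0,a,0)+1$, so it differs from $\zeta_*$ there. 3. The function $\zeta_*(s,\cdot,\cdot)$ itself is a continuous extension of $\zeta(s,\cdot,\cdot)$ to $T$ if and only if $T\subseteq E(s)$. -/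

import Mathlib

open Set

noncomputable section

/-- The meromorphic continuation to `ℂ` of a function `f` given on the half-plane `1 < re s`:
the function `g`, meromorphic on `ℂ` and in normal form (analytic wherever its singularities are
removable, with value `0` at its poles), that agrees with `f` for `1 < re s`. It is unique, see
`merContinuation_eq`. (If there is none, the value is `f` by convention.) -/
def merContinuation (f : ℂ → ℂ) : ℂ → ℂ :=
  open Classical in
  if h : ∃ g : ℂ → ℂ, MeromorphicNFOn g univ ∧ ∀ s : ℂ, 1 < s.re → g s = f s then h.choose else f

/-- The continuation does not depend on any choice. -/
theorem merContinuation_eq {f g : ℂ → ℂ} (hg : MeromorphicNFOn g univ)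
    (hfg : ∀ s : ℂ, 1 < s.re → g s = f s) : merContinuation f = g := by
  have key : ∀ g' : ℂ → ℂ, MeromorphicNFOn g' univ → (∀ s : ℂ, 1 < s.re → g' s = f s) →
      g' = g := by
    intro g' hg' hf'
    have hm : MeromorphicOn (g' - g) univ := fun x hx =>
      (hg' hx).meromorphicAt.sub (hg hx).meromorphicAt
    have h2 : meromorphicOrderAt (g' - g) 2 = ⊤ := by
      rw [meromorphicOrderAt_eq_top_iff]
      have ho : {s : ℂ | 1 < s.re} ∈ nhds (2 : ℂ) :=
        (isOpen_lt continuous_const Complex.continuous_re).mem_nhds (by simp)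
      filter_upwards [mem_nhdsWithin_of_mem_nhds ho] with s hs
      have h1 : 1 < s.re := hs
      simp [hf' s h1, hfg s h1]
    funext x
    have hx : meromorphicOrderAt (g' - g) x = ⊤ := by
      by_contra hne
      exact hm.meromorphicOrderAt_ne_top_of_isPreconnected isPreconnected_univ (mem_univ x)
        (mem_univ 2) hne h2
    have he : g' =ᶠ[nhdsWithin x {x}ᶜ] g := by
      rw [meromorphicOrderAt_eq_top_iff] at hx
      filter_upwards [hx] with z hz
      exact sub_eq_zero.mp hz
    exact (((hg' (mem_univ x)).eventuallyEq_nhdsNE_iff_eventuallyEq_nhds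
      (hg (mem_univ x))).mp he).eq_of_nhds
  have h : ∃ g : ℂ → ℂ, MeromorphicNFOn g univ ∧ ∀ s : ℂ, 1 < s.re → g s = f s := ⟨g, hg, hfg⟩
  rw [merContinuation, dif_pos h]
  exact key _ h.choose_spec.1 h.choose_spec.2

/-- The Dirichlet series `∑_{n ≥ 0} e^{2πina} (n + c)^{-s}` (for `c > 0`, `re s > 1`). -/
def lerchSeries (a c : ℝ) (s : ℂ) : ℂ :=
  ∑' n : ℕ, Complex.exp (2 * Real.pi * Complex.I * n * a) * (((n : ℝ) + c : ℝ) : ℂ) ^ (-s)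

/-- The Lerch zeta function `ζ(s, a, c)` for `0 < a < 1`, `0 < c < 1` and all complex `s`. -/
def lerchZeta (s : ℂ) (a c : ℝ) : ℂ :=
  merContinuation (lerchSeries a c) s

/-- The Dirichlet series `∑_{n ∈ ℤ, n + c > 0} e^{2πina} (n + c)^{-s}` (for `re s > 1`). -/
def extLerchSeries (a c : ℝ) (s : ℂ) : ℂ :=
  ∑' n : ℤ, if 0 < (n : ℝ) + c then
    Complex.exp (2 * Real.pi * Complex.I * n * a) * (((n : ℝ) + c : ℝ) : ℂ) ^ (-s) else 0

/-- The extended Lerch zeta function `ζ_*(s, a, c)` for real `a`, `c` and complex `s`. -/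
def extLerchZeta (s : ℂ) (a c : ℝ) : ℂ :=
  merContinuation (extLerchSeries a c) s

/-- The open unit square of the pairs `(a, c)`. -/
def openSquare : Set (ℝ × ℝ) := Ioo 0 1 ×ˢ Ioo 0 1

/-- For fixed `s`, the function `g` is a continuous extension of `ζ(s, a, c)` from the open unit
square to its union with the set `T` of boundary points. -/
def IsContinuousExtension (s : ℂ) (T : Set (ℝ × ℝ)) (g : ℝ × ℝ → ℂ) : Prop :=
  ContinuousOn g (openSquare ∪ T) ∧ ∀ p ∈ openSquare, g p = lerchZeta s p.1 p.2

/-- The boundary points `(a, c)` to which `ζ_*` extends `ζ(s, a, c)` continuously. -/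
def extensionPoints (s : ℂ) : Set (ℝ × ℝ) :=
  {p | (p.1 = 0 ∧ p.2 ∈ Ioo 0 1 ∧ 1 < s.re) ∨
    (p.1 = 1 ∧ p.2 ∈ Ioo 0 1 ∧ 1 < s.re) ∨
    (p.2 = 0 ∧ p.1 ∈ Ioo 0 1 ∧ s.re < 0) ∨
    (p.2 = 1 ∧ p.1 ∈ Ioo 0 1) ∨
    ((p = (0, 1) ∨ p = (1, 1)) ∧ 1 < s.re)}

/-- The points of the edge `c = 0` when `s = 0`, and no point for any other `s`. -/
def exceptionalPoints (s : ℂ) : Set (ℝ × ℝ) :=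
  {p | s = 0 ∧ p.2 = 0 ∧ p.1 ∈ Ioo 0 1}

end

/-!
The Lerch series `Φ(s, z, c) = ∑ zⁿ (n + c)^{-s}`, `z = e^{2πia}`, satisfies for `0 < re s`
wherever it converges, `‖z‖ ≤ 1`,
`(1 - z) Φ(s, z, c) = c^{-s} - z s ∫₀¹ Φ(s + 1, z, c + t) dt`,
by termwise integration (`one_sub_mul_lerchSum`). The right-hand side involves `Φ` at `s + 1` only,
so the relation continues `Φ` to all `s` when iterated, jointly continuous in `(s, z, c)` for
`‖z‖ ≤ 1`, `z ≠ 1`, `c > 0` and entire in `s` (`continuousOn_lerchPhi`, `differentiable_lerchPhi`).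
Hence nothing happens at the
edge `c = 1`, and on the edge `c = 0` the relation `Φ(s, z, c) = c^{-s} + z Φ(s, z, c + 1)` leaves
only the behaviour of `c^{-s}` as `c → 0+`: it tends to `0` for `re s < 0`, is `1` for `s = 0`
(whence the exceptional value), and has no limit otherwise (`not_tendsto_cpow_nhdsGT_zero`).

For `1 < re s` the series converges uniformly up to `a = 0` and `a = 1`. For `re s ≤ 1` there is no
limit as `z → 1` along the circle, even at a fixed `c` (`not_tendsto_lerchPhi`). In the strip
`0 < re s ≤ 1`, the coefficients `(n + c)^{-s}` differ from those of `Γ(1 - s) (1 - z)^{s - 1}` (of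
`-log (1 - z)` if `s = 1`) by a summable sequence, so the two functions differ by one that is
continuous on the closed disc (`exists_continuousOn_sub_lerchPhi`), and neither
`(1 - z)^{s - 1}` nor `log (1 - z)` has a limit. The other `s` reduce to this strip:
`e^{2πiac} Φ(s + 1, e^{2πia}, c)` is a primitive in `a` of `2πi e^{2πiac} Φ(s, e^{2πia}, c)`, so if
`Φ(s, ·, c)` is bounded near `z = 1` then `Φ(s + 1, ·, c)` is Lipschitz and has a limit
(`exists_tendsto_lerchPhi_add_one_of_bounded`). At the corners with `c = 0` one uses this
unboundedness for `re s ≤ 0` and that of `c^{-s}` for `0 < re s`.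
-/

open Filter Topology MeasureTheory

/-! ### Integrals depending on a parameter -/

theorem continuousOn_intervalIntegral_of_continuousOn {X : Type*} [TopologicalSpace X]
    {f : X → ℝ → ℂ} {D : Set X} {a b : ℝ} (hab : a ≤ b)
    (hf : ContinuousOn (Function.uncurry f) (D ×ˢ Icc a b)) :
    ContinuousOn (fun x => ∫ t in a..b, f x t) D := by
  have hint : ∀ y ∈ D, IntervalIntegrable (f y) volume a b := fun y hy => by
    apply ContinuousOn.intervalIntegrable_of_Icc hab
    exact hf.comp (f := fun t : ℝ => (y, t)) (by fun_prop) fun t ht => ⟨hy, ht⟩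
  intro x hx
  rw [ContinuousWithinAt, Metric.tendsto_nhds]
  intro ε hε
  have hb : 0 < b - a + 1 := by linarith
  obtain ⟨v, hv, h⟩ := isCompact_Icc.mem_uniformity_of_prod hf hx
    (Metric.dist_mem_uniformity (div_pos hε hb))
  filter_upwards [hv, self_mem_nhdsWithin] with y hy hyD
  rw [dist_eq_norm, ← intervalIntegral.integral_sub (hint y hyD) (hint x hx)]
  calc ‖∫ t in a..b, (f y t - f x t)‖ ≤ ε / (b - a + 1) * |b - a| := by
        apply intervalIntegral.norm_integral_le_of_norm_le_const
        intro t ht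
        rw [uIoc_of_le hab] at ht
        have := h y hy t ⟨ht.1.le, ht.2⟩
        rw [← dist_eq_norm]
        exact le_of_lt this
    _ < ε := by
        rw [abs_of_nonneg (by linarith), div_mul_eq_mul_div, div_lt_iff₀ hb]
        nlinarith

/-- An integral over a compact interval of functions holomorphic in a parameter is holomorphic in
that parameter: Cauchy's estimate bounds the derivative of the integrand. -/
theorem differentiableOn_intervalIntegral_of_continuousOn {f : ℂ → ℝ → ℂ} {U : Set ℂ}
    (hU : IsOpen U) {a b : ℝ} (hab : a ≤ b)
    (hf : ContinuousOn (Function.uncurry f) (U ×ˢ Icc a b))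
    (hd : ∀ t ∈ Icc a b, DifferentiableOn ℂ (fun s => f s t) U) :
    DifferentiableOn ℂ (fun s => ∫ t in a..b, f s t) U := by
  have hcont : ∀ s ∈ U, ContinuousOn (f s) (Icc a b) := fun s hs =>
    hf.comp (f := fun t : ℝ => (s, t)) (by fun_prop) fun t ht => ⟨hs, ht⟩
  have hmeas : ∀ s ∈ U, AEStronglyMeasurable (f s) (volume.restrict (uIoc a b)) := fun s hs => by
    rw [uIoc_of_le hab]
    exact ((hcont s hs).mono Ioc_subset_Icc_self).aestronglyMeasurable measurableSet_Ioc
  intro x hx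
  obtain ⟨r, hr, hrU⟩ : ∃ r > 0, Metric.closedBall x (2 * r) ⊆ U := by
    obtain ⟨ρ, hρ, h⟩ := Metric.nhds_basis_closedBall.mem_iff.mp (hU.mem_nhds hx)
    exact ⟨ρ / 2, by positivity, by rwa [mul_div_cancel₀ _ two_ne_zero]⟩
  have hball : Metric.ball x r ⊆ U := fun y hy =>
    hrU (Metric.ball_subset_closedBall (Metric.ball_subset_ball (by linarith) hy))
  obtain ⟨M, hM⟩ := ((isCompact_closedBall x (2 * r)).prod (isCompact_Icc (a := a) (b := b))
    ).exists_bound_of_continuousOn (hf.mono (prod_mono hrU subset_rfl))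
  have hderiv : ∀ t ∈ Icc a b, ∀ y ∈ U, HasDerivAt (fun s => f s t) (deriv (fun s => f s t) y) y :=
    fun t ht y hy => ((hd t ht).differentiableAt (hU.mem_nhds hy)).hasDerivAt
  refine (intervalIntegral.hasDerivAt_integral_of_dominated_loc_of_deriv_le (μ := volume)
    (F := f) (F' := fun y t => deriv (fun s => f s t) y) (bound := fun _ => M / r)
    (Metric.ball_mem_nhds x hr) ?_ ?_ ?_ ?_ ?_ ?_).2.differentiableAt.differentiableWithinAt
  · filter_upwards [hU.mem_nhds hx] with s hs using hmeas s hs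
  · exact (hcont x hx).intervalIntegrable_of_Icc hab
  · -- The derivative is the pointwise limit of difference quotients.
    have hlim : Tendsto (fun n : ℕ => x + ((r / (n + 1) : ℝ) : ℂ)) atTop (𝓝 x) := by
      have h1 : Tendsto (fun n : ℕ => r / ((n : ℝ) + 1)) atTop (𝓝 0) :=
        tendsto_const_nhds.div_atTop (tendsto_natCast_atTop_atTop.atTop_add tendsto_const_nhds)
      simpa using tendsto_const_nhds (x := x).add
        ((Complex.continuous_ofReal.tendsto 0).comp h1)
    have hne : ∀ n : ℕ, x + ((r / (n + 1) : ℝ) : ℂ) ≠ x := fun n => by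
      have : r / ((n : ℝ) + 1) ≠ 0 := by positivity
      exact fun h => this (Complex.ofReal_eq_zero.mp (by simpa only [add_eq_left] using h))
    have hin : ∀ n : ℕ, x + ((r / (n + 1) : ℝ) : ℂ) ∈ U := fun n => by
      apply hrU
      rw [Metric.mem_closedBall, dist_self_add_left, Complex.norm_real, Real.norm_eq_abs,
        abs_of_pos (by positivity)]
      have : r / ((n : ℝ) + 1) ≤ r := div_le_self hr.le (by linarith [n.cast_nonneg (α := ℝ)])
      linarith
    refine aestronglyMeasurable_of_tendsto_ae (f := fun (n : ℕ) t =>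
      slope (fun s => f s t) x (x + ((r / (n + 1) : ℝ) : ℂ))) atTop (fun n => ?_) ?_
    · simp only [slope_def_field, div_eq_mul_inv]
      exact ((hmeas _ (hin n)).sub (hmeas _ hx)).mul aestronglyMeasurable_const
    · rw [ae_restrict_iff' measurableSet_uIoc]
      refine ae_of_all _ fun t ht => ?_
      rw [uIoc_of_le hab] at ht
      have := hasDerivAt_iff_tendsto_slope.mp (hderiv t (Ioc_subset_Icc_self ht) x hx)
      exact this.comp (tendsto_nhdsWithin_iff.mpr ⟨hlim, Eventually.of_forall hne⟩)
  · refine ae_of_all _ fun t ht y hy => ?_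
    rw [uIoc_of_le hab] at ht
    have hy' : dist y x < r := hy
    have hsub : Metric.closedBall y r ⊆ Metric.closedBall x (2 * r) :=
      Metric.closedBall_subset_closedBall' (by linarith)
    refine Complex.norm_deriv_le_of_forall_mem_sphere_norm_le hr ?_ fun w hw =>
      hM (w, t) ⟨hsub (Metric.sphere_subset_closedBall hw), Ioc_subset_Icc_self ht⟩
    exact ((hd t (Ioc_subset_Icc_self ht)).mono (hsub.trans hrU)).diffContOnCl_ball subset_rfl
  · exact intervalIntegrable_const
  · refine ae_of_all _ fun t ht y hy => ?_
    rw [uIoc_of_le hab] at ht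
    exact hderiv t (Ioc_subset_Icc_self ht) y (hball hy)

/-! ### The Lerch series -/

/-- The Lerch series `∑ zⁿ (n + c)^{-s}`, with an arbitrary complex `z` in place of `e^{2πia}`. -/
noncomputable def lerchSum (s z : ℂ) (c : ℝ) : ℂ :=
  ∑' n : ℕ, z ^ n * ((n + c : ℝ) : ℂ) ^ (-s)

theorem norm_pow_mul_cpow_neg_le {s z : ℂ} {x : ℝ} (hz : ‖z‖ ≤ 1) (hx : 0 < x) (n : ℕ) :
    ‖z ^ n * (x : ℂ) ^ (-s)‖ ≤ x ^ (-s.re) := by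
  rw [norm_mul, norm_pow, Complex.norm_cpow_eq_rpow_re_of_pos hx, Complex.neg_re]
  exact mul_le_of_le_one_left (by positivity) (pow_le_one₀ (norm_nonneg z) hz)

theorem summable_nat_add_one_rpow_neg {σ : ℝ} (hσ : 1 < σ) :
    Summable fun n : ℕ => ((n : ℝ) + 1) ^ (-σ) := by
  have := (summable_nat_add_iff 1).mpr (Real.summable_nat_rpow.mpr (show -σ < -1 by linarith))
  simpa using this

theorem norm_lerch_succ_term_le {s z : ℂ} {c σ : ℝ} (hσ : 0 ≤ σ) (hs : σ ≤ s.re) (hz : ‖z‖ ≤ 1)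
    (hc : 0 ≤ c) (n : ℕ) :
    ‖z ^ (n + 1) * (((n + 1 : ℕ) + c : ℝ) : ℂ) ^ (-s)‖ ≤ ((n : ℝ) + 1) ^ (-σ) := by
  have hn : (0 : ℝ) ≤ n := n.cast_nonneg
  have hx : (0 : ℝ) < (n + 1 : ℕ) + c := by push_cast; linarith
  calc _ ≤ (((n + 1 : ℕ) : ℝ) + c) ^ (-s.re) := norm_pow_mul_cpow_neg_le hz hx _
    _ ≤ ((n : ℝ) + 1) ^ (-s.re) :=
        Real.rpow_le_rpow_of_nonpos (by linarith) (by push_cast; linarith) (by linarith)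
    _ ≤ ((n : ℝ) + 1) ^ (-σ) := Real.rpow_le_rpow_of_exponent_le (by linarith) (by linarith)

theorem summable_rpow_neg_nat_add {σ c : ℝ} (hσ : 1 < σ) (hc : 0 < c) :
    Summable fun n : ℕ => ((n : ℝ) + c) ^ (-σ) := by
  rw [← summable_nat_add_iff 1]
  refine (summable_nat_add_one_rpow_neg hσ).of_nonneg_of_le (fun n => by positivity) fun n => ?_
  exact Real.rpow_le_rpow_of_nonpos (by positivity) (by push_cast; linarith) (by linarith)

theorem summable_lerch {s z : ℂ} {c : ℝ} (hs : 1 < s.re) (hz : ‖z‖ ≤ 1) (hc : 0 < c) :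
    Summable fun n : ℕ => z ^ n * ((n + c : ℝ) : ℂ) ^ (-s) :=
  (summable_rpow_neg_nat_add hs hc).of_norm_bounded fun n =>
    norm_pow_mul_cpow_neg_le hz (by positivity) n

theorem summable_lerch_of_norm_lt_one {s z : ℂ} {c : ℝ} (hs : 0 ≤ s.re) (hz : ‖z‖ < 1)
    (hc : 0 < c) : Summable fun n : ℕ => z ^ n * ((n + c : ℝ) : ℂ) ^ (-s) := by
  refine ((summable_geometric_of_lt_one (norm_nonneg z) hz).mul_right
    (c ^ (-s.re))).of_norm_bounded fun n => ?_
  have hn : (0 : ℝ) ≤ n := n.cast_nonneg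
  rw [norm_mul, norm_pow, Complex.norm_cpow_eq_rpow_re_of_pos (by linarith), Complex.neg_re]
  gcongr ?_ * ?_
  exact Real.rpow_le_rpow_of_nonpos hc (by linarith) (by linarith)

theorem lerchSum_eq_add_tsum {s z : ℂ} {c : ℝ} (hs : 1 < s.re) (hz : ‖z‖ ≤ 1) (hc : 0 < c) :
    lerchSum s z c =
      (c : ℂ) ^ (-s) + ∑' n : ℕ, z ^ (n + 1) * (((n + 1 : ℕ) + c : ℝ) : ℂ) ^ (-s) := by
  rw [lerchSum, (summable_lerch hs hz hc).tsum_eq_zero_add]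
  simp

theorem continuousOn_lerchSum :
    ContinuousOn (fun p : ℂ × ℂ × ℝ => lerchSum p.1 p.2.1 p.2.2)
      {p | 1 < p.1.re ∧ ‖p.2.1‖ ≤ 1 ∧ 0 < p.2.2} := by
  rintro ⟨s, z, c⟩ ⟨hs, hz, hc⟩
  dsimp only at hs hz hc
  set σ := (1 + s.re) / 2 with hσ
  have hσ1 : 1 < σ := by linarith
  set D : Set (ℂ × ℂ × ℝ) := {p | σ < p.1.re ∧ ‖p.2.1‖ ≤ 1 ∧ 0 < p.2.2}
  have key : ContinuousOn (fun p : ℂ × ℂ × ℝ => lerchSum p.1 p.2.1 p.2.2) D := by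
    have : ContinuousOn (fun p : ℂ × ℂ × ℝ => (p.2.2 : ℂ) ^ (-p.1) +
        ∑' n : ℕ, p.2.1 ^ (n + 1) * (((n + 1 : ℕ) + p.2.2 : ℝ) : ℂ) ^ (-p.1)) D := by
      refine ContinuousOn.add ?_ (continuousOn_tsum (fun n => ?_)
        (summable_nat_add_one_rpow_neg hσ1) fun n p hp =>
          norm_lerch_succ_term_le (by linarith) hp.1.le hp.2.1 hp.2.2.le n)
      · refine ContinuousOn.cpow (by fun_prop) (by fun_prop) fun p hp => ?_
        exact Complex.ofReal_mem_slitPlane.mpr hp.2.2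
      · refine ContinuousOn.mul (by fun_prop) (ContinuousOn.cpow (by fun_prop) (by fun_prop) ?_)
        intro p hp
        have := hp.2.2
        exact Complex.ofReal_mem_slitPlane.mpr (by positivity)
    refine this.congr fun p hp => lerchSum_eq_add_tsum (hσ1.trans hp.1) hp.2.1 hp.2.2
  have hmem : D ∈ 𝓝[{p : ℂ × ℂ × ℝ | 1 < p.1.re ∧ ‖p.2.1‖ ≤ 1 ∧ 0 < p.2.2}] (s, z, c) := by
    have ho : IsOpen {p : ℂ × ℂ × ℝ | σ < p.1.re} := isOpen_lt continuous_const (by fun_prop)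
    filter_upwards [self_mem_nhdsWithin, mem_nhdsWithin_of_mem_nhds
      (ho.mem_nhds (show σ < s.re by linarith))] with p hp hp'
    exact ⟨hp', hp.2⟩
  exact (key (s, z, c) ⟨by change σ < s.re; linarith, hz, hc⟩).mono_of_mem_nhdsWithin hmem

theorem differentiableOn_lerchSum {z : ℂ} {c : ℝ} (hz : ‖z‖ ≤ 1) (hc : 0 < c) :
    DifferentiableOn ℂ (fun s => lerchSum s z c) {s | 1 < s.re} := by
  intro s hs
  have hs' : 1 < s.re := hs
  set σ := (1 + s.re) / 2 with hσ
  have ho : IsOpen {w : ℂ | σ < w.re} := isOpen_lt continuous_const Complex.continuous_re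
  have hterm : ∀ x : ℝ, 0 < x → Differentiable ℂ fun w : ℂ => (x : ℂ) ^ (-w) := fun x hx =>
    differentiable_neg.const_cpow (Or.inl (Complex.ofReal_ne_zero.mpr hx.ne'))
  have key : DifferentiableOn ℂ (fun w => lerchSum w z c) {w | σ < w.re} := by
    have : DifferentiableOn ℂ (fun w : ℂ => (c : ℂ) ^ (-w) +
        ∑' n : ℕ, z ^ (n + 1) * (((n + 1 : ℕ) + c : ℝ) : ℂ) ^ (-w)) {w | σ < w.re} := by
      refine (hterm c hc).differentiableOn.add (Complex.differentiableOn_tsum_of_summable_norm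
        (summable_nat_add_one_rpow_neg (show 1 < σ by linarith)) (fun n => ?_) ho fun n w hw =>
          norm_lerch_succ_term_le (by linarith) (le_of_lt hw) hz hc.le n)
      exact ((hterm _ (by positivity)).const_mul _).differentiableOn
    refine this.congr fun w hw => lerchSum_eq_add_tsum ?_ hz hc
    have : σ < w.re := hw
    linarith
  exact (key.differentiableAt (ho.mem_nhds (show σ < s.re by linarith))).differentiableWithinAt

theorem neg_mul_integral_cpow {s : ℂ} {x : ℝ} (hx : 0 < x) :
    -s * ∫ t in (0 : ℝ)..1, ((x + t : ℝ) : ℂ) ^ (-(s + 1)) =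
      ((x + 1 : ℝ) : ℂ) ^ (-s) - (x : ℂ) ^ (-s) := by
  rw [← intervalIntegral.integral_const_mul]
  have hpos : ∀ t ∈ uIcc (0 : ℝ) 1, 0 < x + t := fun t ht => by
    rw [uIcc_of_le zero_le_one] at ht
    linarith [ht.1]
  rw [intervalIntegral.integral_eq_sub_of_hasDerivAt
    (f := fun t : ℝ => ((x + t : ℝ) : ℂ) ^ (-s))]
  · simp
  · intro t ht
    have h1 := (((hasDerivAt_id (t : ℂ)).const_add (x : ℂ)).cpow_const (c := -s)
      (Or.inl (by simpa using hpos t ht))).comp_ofReal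
    simpa [show -s - 1 = -(s + 1) by ring] using h1
  · refine ContinuousOn.intervalIntegrable fun t ht => ContinuousAt.continuousWithinAt ?_
    exact continuousAt_const.mul (ContinuousAt.cpow (by fun_prop) (by fun_prop)
      (Complex.ofReal_mem_slitPlane.mpr (hpos t ht)))

/-- Termwise integration over `[c, c + 1]` turns the series at `s + 1` into the series of
differences at `s`, which converges in the larger half-plane `0 < re s`. -/
theorem hasSum_lerch_sub {s z : ℂ} {c : ℝ} (hs : 0 < s.re) (hz : ‖z‖ ≤ 1) (hc : 0 < c) :
    HasSum (fun n : ℕ => z ^ n * (((n + c + 1 : ℝ) : ℂ) ^ (-s) - ((n + c : ℝ) : ℂ) ^ (-s)))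
      (-s * ∫ t in (0 : ℝ)..1, lerchSum (s + 1) z (c + t)) := by
  have hs1 : 1 < (s + 1).re := by simpa using hs
  have h : HasSum
      (fun n : ℕ => ∫ t in (0 : ℝ)..1, z ^ n * ((n + (c + t) : ℝ) : ℂ) ^ (-(s + 1)))
      (∫ t in (0 : ℝ)..1, lerchSum (s + 1) z (c + t)) := by
    refine intervalIntegral.hasSum_integral_of_dominated_convergence
      (fun n _ => ((n : ℝ) + c) ^ (-(s + 1).re)) (fun n => ?_) (fun n => ?_) ?_
      intervalIntegrable_const ?_
    · rw [uIoc_of_le zero_le_one]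
      refine ContinuousOn.aestronglyMeasurable (fun t ht => ContinuousAt.continuousWithinAt ?_)
        measurableSet_Ioc
      have := ht.1
      exact continuousAt_const.mul (ContinuousAt.cpow (by fun_prop) (by fun_prop)
        (Complex.ofReal_mem_slitPlane.mpr (by positivity)))
    · refine ae_of_all _ fun t ht => ?_
      rw [uIoc_of_le zero_le_one] at ht
      have := ht.1
      refine (norm_pow_mul_cpow_neg_le hz (by positivity) n).trans ?_
      exact Real.rpow_le_rpow_of_nonpos (by positivity) (by linarith) (by linarith)
    · exact ae_of_all _ fun t _ => summable_rpow_neg_nat_add hs1 hc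
    · refine ae_of_all _ fun t ht => ?_
      rw [uIoc_of_le zero_le_one] at ht
      exact (summable_lerch hs1 hz (by linarith [ht.1])).hasSum
  refine (h.mul_left (-s)).congr_fun fun n => ?_
  rw [intervalIntegral.integral_const_mul, mul_left_comm, ← neg_mul_integral_cpow (by positivity)]
  simp only [add_assoc]

/-- The recursion that lowers `re s` by one, for the series itself. -/
theorem one_sub_mul_lerchSum {s z : ℂ} {c : ℝ} (hs : 0 < s.re) (hz : ‖z‖ ≤ 1) (hc : 0 < c)
    (hsum : Summable fun n : ℕ => z ^ n * ((n + c : ℝ) : ℂ) ^ (-s)) :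
    (1 - z) * lerchSum s z c =
      (c : ℂ) ^ (-s) - z * s * ∫ t in (0 : ℝ)..1, lerchSum (s + 1) z (c + t) := by
  have h1 := hsum.hasSum
  have h2 := (hasSum_lerch_sub hs hz hc).add h1
  have h3 : HasSum (fun n : ℕ => z ^ (n + 1) * (((n + 1 : ℕ) + c : ℝ) : ℂ) ^ (-s))
      (z * (-s * (∫ t in (0 : ℝ)..1, lerchSum (s + 1) z (c + t)) + lerchSum s z c)) := by
    refine (h2.mul_left z).congr_fun fun n => ?_
    push_cast
    ring_nf
  have h4 := hsum.tsum_eq_zero_add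
  rw [h3.tsum_eq] at h4
  change lerchSum s z c = _ at h4
  simp only [pow_zero, Nat.cast_zero, zero_add, one_mul] at h4
  linear_combination h4

/-! ### Analytic continuation of the Lerch series -/

/-- The `k`-fold use of the recursion
`(1 - z) Φ(s, z, c) = c^{-s} - z s ∫₀¹ Φ(s + 1, z, c + t) dt`, starting from the Lerch series;
it continues the series to the half-plane `1 - k < re s`. -/
noncomputable def lerchAux : ℕ → ℂ → ℂ → ℝ → ℂ
  | 0 => lerchSum
  | k + 1 => fun s z c =>
    ((c : ℂ) ^ (-s) - z * s * ∫ t in (0 : ℝ)..1, lerchAux k (s + 1) z (c + t)) / (1 - z)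

/-- The continuation `Φ(s, z, c)` of the Lerch series to all `s`, for `‖z‖ ≤ 1`, `z ≠ 1` and
`c > 0`, computed with as many steps of the recursion as `s` requires. -/
noncomputable def lerchPhi (s z : ℂ) (c : ℝ) : ℂ :=
  lerchAux (⌊1 - s.re⌋₊ + 1) s z c

theorem continuousOn_lerchAux (k : ℕ) :
    ContinuousOn (fun p : ℂ × ℂ × ℝ => lerchAux k p.1 p.2.1 p.2.2)
      {p | 1 - k < p.1.re ∧ ‖p.2.1‖ ≤ 1 ∧ p.2.1 ≠ 1 ∧ 0 < p.2.2} := by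
  induction k with
  | zero =>
    refine continuousOn_lerchSum.mono fun p hp => ?_
    simp only [mem_ofPred_eq, Nat.cast_zero, sub_zero] at hp ⊢
    exact ⟨hp.1, hp.2.1, hp.2.2.2⟩
  | succ k ih =>
    refine ContinuousOn.div (ContinuousOn.sub ?_ (ContinuousOn.mul (by fun_prop) ?_))
      (by fun_prop) fun p hp => sub_ne_zero.mpr hp.2.2.1.symm
    · exact ContinuousOn.cpow (by fun_prop) (by fun_prop) fun p hp =>
        Complex.ofReal_mem_slitPlane.mpr hp.2.2.2
    · refine continuousOn_intervalIntegral_of_continuousOn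
        (f := fun (p : ℂ × ℂ × ℝ) t => lerchAux k (p.1 + 1) p.2.1 (p.2.2 + t)) zero_le_one ?_
      refine ih.comp (f := fun q : (ℂ × ℂ × ℝ) × ℝ => (q.1.1 + 1, q.1.2.1, q.1.2.2 + q.2))
        (by fun_prop) ?_
      rintro ⟨p, t⟩ ⟨⟨h1, h2, h3, h4⟩, ht⟩
      simp only [mem_ofPred_eq, Complex.add_re, Complex.one_re] at *
      push_cast at h1
      exact ⟨by linarith, h2, h3, by linarith [ht.1]⟩

theorem isOpen_lt_re (x : ℝ) : IsOpen {s : ℂ | x < s.re} :=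
  isOpen_lt continuous_const Complex.continuous_re

theorem differentiableOn_lerchAux {z : ℂ} (hz : ‖z‖ ≤ 1) (hz1 : z ≠ 1) (k : ℕ) {c : ℝ}
    (hc : 0 < c) : DifferentiableOn ℂ (fun s => lerchAux k s z c) {s | 1 - k < s.re} := by
  induction k generalizing c with
  | zero => simpa [lerchAux] using differentiableOn_lerchSum hz hc
  | succ k ih =>
    have hmaps : ∀ s : ℂ, 1 - ((k + 1 : ℕ) : ℝ) < s.re → 1 - (k : ℝ) < (s + 1).re := fun s hs => by
      push_cast at hs
      simp only [Complex.add_re, Complex.one_re]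
      linarith
    refine DifferentiableOn.div_const (DifferentiableOn.sub ?_ (DifferentiableOn.mul
      (by fun_prop) ?_)) _
    · exact (differentiable_neg.const_cpow
        (Or.inl (Complex.ofReal_ne_zero.mpr hc.ne'))).differentiableOn
    · refine differentiableOn_intervalIntegral_of_continuousOn (isOpen_lt_re _) zero_le_one ?_
        fun t ht => ?_
      · refine (continuousOn_lerchAux k).comp (f := fun q : ℂ × ℝ => (q.1 + 1, z, c + q.2))
          (by fun_prop) ?_
        rintro ⟨s, t⟩ ⟨hs, ht⟩
        exact ⟨hmaps s hs, hz, hz1, by linarith [ht.1]⟩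
      · exact (ih (by linarith [ht.1])).comp (by fun_prop) fun s hs => hmaps s hs

/-- One step of the recursion reproduces the series wherever it converges with `0 < re s`; inside
the unit disc this includes the strip `0 < re s ≤ 1`. -/
theorem lerchAux_one_eq_lerchSum {s z : ℂ} {c : ℝ} (hs : 0 < s.re) (hz : ‖z‖ ≤ 1) (hz1 : z ≠ 1)
    (hc : 0 < c) (hsum : Summable fun n : ℕ => z ^ n * ((n + c : ℝ) : ℂ) ^ (-s)) :
    lerchAux 1 s z c = lerchSum s z c := by
  change (_ - z * s * ∫ t in (0 : ℝ)..1, lerchSum (s + 1) z (c + t)) / (1 - z) = _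
  rw [div_eq_iff (sub_ne_zero.mpr hz1.symm), ← one_sub_mul_lerchSum hs hz hc hsum, mul_comm]

theorem lerchAux_succ_eq {z : ℂ} (hz : ‖z‖ ≤ 1) (hz1 : z ≠ 1) (k : ℕ) {s : ℂ} {c : ℝ}
    (hs : 1 - k < s.re) (hc : 0 < c) : lerchAux (k + 1) s z c = lerchAux k s z c := by
  induction k generalizing s c with
  | zero =>
    have hs' : 1 < s.re := by simpa using hs
    exact lerchAux_one_eq_lerchSum (by linarith) hz hz1 hc (summable_lerch hs' hz hc)
  | succ k ih =>
    push_cast at hs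
    have h : ∫ t in (0 : ℝ)..1, lerchAux (k + 1) (s + 1) z (c + t) =
        ∫ t in (0 : ℝ)..1, lerchAux k (s + 1) z (c + t) := by
      refine intervalIntegral.integral_congr fun t ht => ?_
      rw [uIcc_of_le zero_le_one] at ht
      exact ih (by simp only [Complex.add_re, Complex.one_re]; linarith) (by linarith [ht.1])
    change (_ - z * s * ∫ t in (0 : ℝ)..1, lerchAux (k + 1) (s + 1) z (c + t)) / _ = _
    rw [h]
    rfl

theorem lerchAux_eq_of_le {z : ℂ} (hz : ‖z‖ ≤ 1) (hz1 : z ≠ 1) {k m : ℕ} (hkm : k ≤ m) {s : ℂ}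
    {c : ℝ} (hs : 1 - k < s.re) (hc : 0 < c) : lerchAux m s z c = lerchAux k s z c := by
  induction m, hkm using Nat.le_induction with
  | base => rfl
  | succ m hm ih =>
    have : (k : ℝ) ≤ m := Nat.cast_le.mpr hm
    rw [lerchAux_succ_eq hz hz1 m (by linarith) hc, ih]

theorem lerchPhi_eq_lerchAux {z : ℂ} (hz : ‖z‖ ≤ 1) (hz1 : z ≠ 1) (k : ℕ) {s : ℂ} {c : ℝ}
    (hs : 1 - k < s.re) (hc : 0 < c) : lerchPhi s z c = lerchAux k s z c := by
  have h : 1 - ((⌊1 - s.re⌋₊ + 1 : ℕ) : ℝ) < s.re := by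
    have := Nat.lt_floor_add_one (1 - s.re)
    push_cast
    linarith
  rcases le_total k (⌊1 - s.re⌋₊ + 1) with hk | hk
  · exact lerchAux_eq_of_le hz hz1 hk hs hc
  · exact (lerchAux_eq_of_le hz hz1 hk h hc).symm

theorem lerchPhi_eq_lerchSum {s z : ℂ} {c : ℝ} (hs : 1 < s.re) (hz : ‖z‖ ≤ 1) (hz1 : z ≠ 1)
    (hc : 0 < c) : lerchPhi s z c = lerchSum s z c :=
  lerchPhi_eq_lerchAux hz hz1 0 (by simpa using hs) hc

theorem lerchPhi_eq_lerchSum_of_norm_lt_one {s z : ℂ} {c : ℝ} (hs : 0 < s.re) (hz : ‖z‖ < 1)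
    (hc : 0 < c) : lerchPhi s z c = lerchSum s z c := by
  have hz1 : z ≠ 1 := by
    rintro rfl
    simp at hz
  rw [lerchPhi_eq_lerchAux hz.le hz1 1 (by simpa using hs) hc]
  exact lerchAux_one_eq_lerchSum hs hz.le hz1 hc (summable_lerch_of_norm_lt_one hs.le hz hc)

theorem continuousOn_lerchPhi :
    ContinuousOn (fun p : ℂ × ℂ × ℝ => lerchPhi p.1 p.2.1 p.2.2)
      {p | ‖p.2.1‖ ≤ 1 ∧ p.2.1 ≠ 1 ∧ 0 < p.2.2} := by
  rintro ⟨s, z, c⟩ ⟨hz, hz1, hc⟩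
  obtain ⟨k, hk⟩ := exists_nat_gt (1 - s.re)
  have hs : 1 - (k : ℝ) < s.re := by linarith
  set D : Set (ℂ × ℂ × ℝ) := {p | 1 - k < p.1.re ∧ ‖p.2.1‖ ≤ 1 ∧ p.2.1 ≠ 1 ∧ 0 < p.2.2}
  have key : ContinuousOn (fun p : ℂ × ℂ × ℝ => lerchPhi p.1 p.2.1 p.2.2) D :=
    (continuousOn_lerchAux k).congr fun p hp =>
      lerchPhi_eq_lerchAux hp.2.1 hp.2.2.1 k hp.1 hp.2.2.2
  refine (key (s, z, c) ⟨hs, hz, hz1, hc⟩).mono_of_mem_nhdsWithin ?_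
  filter_upwards [self_mem_nhdsWithin, mem_nhdsWithin_of_mem_nhds
    (((isOpen_lt_re (1 - k)).preimage continuous_fst).mem_nhds hs)] with p hp hp'
  exact ⟨hp', hp⟩

theorem differentiable_lerchPhi {z : ℂ} (hz : ‖z‖ ≤ 1) (hz1 : z ≠ 1) {c : ℝ} (hc : 0 < c) :
    Differentiable ℂ fun s => lerchPhi s z c := by
  intro s
  obtain ⟨k, hk⟩ := exists_nat_gt (1 - s.re)
  have key : DifferentiableOn ℂ (fun s => lerchPhi s z c) {s | 1 - k < s.re} :=
    (differentiableOn_lerchAux hz hz1 k hc).congr fun w hw => lerchPhi_eq_lerchAux hz hz1 k hw hc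
  exact key.differentiableAt ((isOpen_lt_re _).mem_nhds (show 1 - (k : ℝ) < s.re by linarith))

/-- Entire functions that agree on the half-plane `1 < re s` are equal. -/
theorem Differentiable.eq_of_eq_of_one_lt_re {f g : ℂ → ℂ} (hf : Differentiable ℂ f)
    (hg : Differentiable ℂ g) (h : ∀ s : ℂ, 1 < s.re → f s = g s) : f = g := by
  refine AnalyticOnNhd.eq_of_eventuallyEq (z₀ := 2) (fun s _ => hf.analyticAt s)
    (fun s _ => hg.analyticAt s) ?_
  filter_upwards [(isOpen_lt_re 1).mem_nhds (show (1 : ℝ) < (2 : ℂ).re by simp)] with s hs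
  exact h s hs

/-- The first term split off, for all `s` by uniqueness of the continuation. -/
theorem lerchPhi_eq_cpow_add {z : ℂ} (hz : ‖z‖ ≤ 1) (hz1 : z ≠ 1) {c : ℝ} (hc : 0 < c) (s : ℂ) :
    lerchPhi s z c = (c : ℂ) ^ (-s) + z * lerchPhi s z (c + 1) := by
  have hc1 : 0 < c + 1 := by linarith
  have hg : Differentiable ℂ fun s => (c : ℂ) ^ (-s) + z * lerchPhi s z (c + 1) :=
    (differentiable_neg.const_cpow (Or.inl (Complex.ofReal_ne_zero.mpr hc.ne'))).add
      ((differentiable_lerchPhi hz hz1 hc1).const_mul z)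
  refine congrFun ((differentiable_lerchPhi hz hz1 hc).eq_of_eq_of_one_lt_re hg fun w hw => ?_) s
  rw [lerchPhi_eq_lerchSum hw hz hz1 hc, lerchPhi_eq_lerchSum hw hz hz1 hc1,
    lerchSum_eq_add_tsum hw hz hc, lerchSum, ← tsum_mul_left]
  congr 2 with n
  push_cast
  ring_nf

/-! ### The functions of the statement in terms of the continuation -/

/-- The point `e^{2πiθ}` of the unit circle. -/
noncomputable def circlePoint (θ : ℝ) : ℂ :=
  Complex.exp (2 * Real.pi * Complex.I * θ)

theorem norm_circlePoint (θ : ℝ) : ‖circlePoint θ‖ = 1 := by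
  rw [circlePoint, show 2 * (Real.pi : ℂ) * Complex.I * θ = ((2 * Real.pi * θ : ℝ) : ℂ) * Complex.I
    by push_cast; ring]
  exact Complex.norm_exp_ofReal_mul_I _

theorem continuous_circlePoint : Continuous circlePoint := by
  unfold circlePoint
  fun_prop

theorem circlePoint_ne_one {θ : ℝ} (h0 : θ ≠ 0) (h1 : |θ| < 1) : circlePoint θ ≠ 1 := by
  rw [circlePoint, Ne, Complex.exp_eq_one_iff]
  rintro ⟨n, hn⟩
  have h2 : (θ : ℂ) = n := by
    have := Complex.two_pi_I_ne_zero
    apply mul_left_cancel₀ this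
    linear_combination hn
  have h3 : θ = n := by exact_mod_cast h2
  rw [h3] at h0 h1
  have h4 : |n| < 1 := by exact_mod_cast h1
  exact h0 (by rw [Int.abs_lt_one_iff.mp h4, Int.cast_zero])

theorem circlePoint_sub_one (θ : ℝ) : circlePoint (θ - 1) = circlePoint θ := by
  rw [circlePoint, circlePoint, Complex.ofReal_sub, mul_sub, Complex.exp_sub, Complex.ofReal_one,
    mul_one, Complex.exp_two_pi_mul_I, div_one]

theorem circlePoint_zero : circlePoint 0 = 1 := by simp [circlePoint]

theorem lerchSeries_eq_lerchSum (a c : ℝ) (s : ℂ) :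
    lerchSeries a c s = lerchSum s (circlePoint a) c := by
  refine tsum_congr fun n => ?_
  rw [circlePoint, ← Complex.exp_nat_mul]
  congr 2
  ring

theorem extLerchSeries_of_pos_of_le_one {a c : ℝ} (hc : 0 < c) (hc1 : c ≤ 1) (s : ℂ) :
    extLerchSeries a c s = lerchSeries a c s := by
  have h := (Nat.cast_injective (R := ℤ)).tsum_eq (f := fun n : ℤ => if 0 < (n : ℝ) + c then
    Complex.exp (2 * Real.pi * Complex.I * n * a) * (((n : ℝ) + c : ℝ) : ℂ) ^ (-s) else 0)
    fun n hn => ?_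
  · rw [extLerchSeries, ← h, lerchSeries]
    refine tsum_congr fun n => ?_
    rw [if_pos (by push_cast; positivity)]
    push_cast
    rfl
  · have h0 : 0 < (n : ℝ) + c := by
      by_contra h0
      exact hn (if_neg h0)
    have h1 : (-1 : ℝ) < n := by linarith
    have h2 : -1 < n := by exact_mod_cast h1
    exact ⟨n.toNat, by simp; omega⟩

theorem extLerchSeries_zero_right (a : ℝ) (s : ℂ) :
    extLerchSeries a 0 s = circlePoint a * lerchSeries a 1 s := by
  have hinj : Function.Injective fun n : ℕ => (n : ℤ) + 1 := fun m n h => by simpa using h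
  have h := hinj.tsum_eq (f := fun n : ℤ => if 0 < (n : ℝ) + ((0 : ℝ)) then
    Complex.exp (2 * Real.pi * Complex.I * n * a) * (((n : ℝ) + (0 : ℝ) : ℝ) : ℂ) ^ (-s) else 0)
    fun n hn => ?_
  · rw [extLerchSeries, ← h, lerchSeries, ← tsum_mul_left]
    refine tsum_congr fun n => ?_
    rw [if_pos (by push_cast; positivity), circlePoint, ← mul_assoc, ← Complex.exp_add]
    push_cast
    ring_nf
  · have h0 : 0 < (n : ℝ) + 0 := by
      by_contra h0
      exact hn (if_neg h0)
    have h2 : 0 < n := by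
      rw [add_zero] at h0
      exact_mod_cast h0
    exact ⟨n.toNat - 1, by simp; omega⟩

/-- No continuation need exist here: on `1 < re s` the value is that of `f` in either case of the
definition. -/
theorem merContinuation_of_one_lt_re (f : ℂ → ℂ) {s : ℂ} (hs : 1 < s.re) :
    merContinuation f s = f s := by
  unfold merContinuation
  split_ifs with h
  · exact h.choose_spec.2 s hs
  · rfl

theorem merContinuation_eq_of_differentiable {f g : ℂ → ℂ} (hg : Differentiable ℂ g)
    (hfg : ∀ s : ℂ, 1 < s.re → g s = f s) : merContinuation f = g :=
  merContinuation_eq (fun s _ => (hg.analyticAt s).meromorphicNFAt) hfg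

theorem circlePoint_ne_one_of_mem_Ioo {a : ℝ} (ha : a ∈ Ioo 0 1) : circlePoint a ≠ 1 :=
  circlePoint_ne_one ha.1.ne' (by rw [abs_of_pos ha.1]; exact ha.2)

theorem merContinuation_lerchSeries {a c : ℝ} (ha : a ∈ Ioo 0 1) (hc : 0 < c) :
    merContinuation (lerchSeries a c) = fun s => lerchPhi s (circlePoint a) c := by
  have hz1 := circlePoint_ne_one_of_mem_Ioo ha
  refine merContinuation_eq_of_differentiable
    (differentiable_lerchPhi (norm_circlePoint a).le hz1 hc) fun w hw => ?_
  rw [lerchPhi_eq_lerchSum hw (norm_circlePoint a).le hz1 hc, lerchSeries_eq_lerchSum]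

theorem lerchZeta_eq_lerchPhi {a c : ℝ} (ha : a ∈ Ioo 0 1) (hc : 0 < c) (s : ℂ) :
    lerchZeta s a c = lerchPhi s (circlePoint a) c := by
  rw [lerchZeta, merContinuation_lerchSeries ha hc]

theorem extLerchZeta_eq_lerchPhi {a c : ℝ} (ha : a ∈ Ioo 0 1) (hc : 0 < c) (hc1 : c ≤ 1)
    (s : ℂ) : extLerchZeta s a c = lerchPhi s (circlePoint a) c := by
  rw [extLerchZeta, funext (extLerchSeries_of_pos_of_le_one hc hc1),
    merContinuation_lerchSeries ha hc]

theorem extLerchZeta_zero_right {a : ℝ} (ha : a ∈ Ioo 0 1) (s : ℂ) :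
    extLerchZeta s a 0 = circlePoint a * lerchPhi s (circlePoint a) 1 := by
  have hz1 := circlePoint_ne_one_of_mem_Ioo ha
  have hz := (norm_circlePoint a).le
  rw [extLerchZeta, merContinuation_eq_of_differentiable
    ((differentiable_lerchPhi hz hz1 one_pos).const_mul (circlePoint a)) fun w hw => ?_]
  rw [lerchPhi_eq_lerchSum hw hz hz1 one_pos, extLerchSeries_zero_right, lerchSeries_eq_lerchSum]

theorem extLerchZeta_of_one_lt_re {s : ℂ} (hs : 1 < s.re) {a c : ℝ} (hc : 0 < c) (hc1 : c ≤ 1) :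
    extLerchZeta s a c = lerchSum s (circlePoint a) c := by
  rw [extLerchZeta, merContinuation_of_one_lt_re _ hs, extLerchSeries_of_pos_of_le_one hc hc1,
    lerchSeries_eq_lerchSum]

/-! ### Variation along the unit circle -/

theorem norm_circlePoint_mul (θ : ℝ) (w : ℂ) : ‖circlePoint θ * w‖ = ‖w‖ := by
  rw [norm_mul, norm_circlePoint, one_mul]

theorem hasDerivAt_circlePoint_mul (x θ : ℝ) :
    HasDerivAt (fun θ : ℝ => circlePoint (θ * x))
      (2 * Real.pi * Complex.I * x * circlePoint (θ * x)) θ := by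
  have h := (((hasDerivAt_id (θ : ℂ)).mul_const (x : ℂ)).const_mul
    (2 * Real.pi * Complex.I)).cexp.comp_ofReal
  simp only [circlePoint, Complex.ofReal_mul, id, one_mul] at h ⊢
  convert h using 1
  ring

theorem circlePoint_mul_lerchSum (s : ℂ) (c θ : ℝ) :
    circlePoint (θ * c) * lerchSum s (circlePoint θ) c =
      ∑' n : ℕ, circlePoint (θ * (n + c)) * ((n + c : ℝ) : ℂ) ^ (-s) := by
  rw [lerchSum, ← tsum_mul_left]
  refine tsum_congr fun n => ?_
  rw [← mul_assoc]
  congr 1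
  simp only [circlePoint]
  rw [← Complex.exp_nat_mul, ← Complex.exp_add]
  push_cast
  ring_nf

theorem hasDerivAt_circlePoint_mul_lerchSum {s : ℂ} {c : ℝ} (hs : 1 < s.re) (hc : 0 < c)
    (θ : ℝ) : HasDerivAt (fun θ : ℝ => circlePoint (θ * c) * lerchSum (s + 1) (circlePoint θ) c)
      (2 * Real.pi * Complex.I * (circlePoint (θ * c) * lerchSum s (circlePoint θ) c)) θ := by
  simp only [circlePoint_mul_lerchSum, ← tsum_mul_left]
  have hnorm : ∀ (w : ℂ) (n : ℕ) (θ : ℝ),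
      ‖circlePoint (θ * (n + c)) * ((n + c : ℝ) : ℂ) ^ (-w)‖ = ((n : ℝ) + c) ^ (-w.re) := by
    intro w n θ
    rw [norm_circlePoint_mul, Complex.norm_cpow_eq_rpow_re_of_pos (by positivity), Complex.neg_re]
  refine hasDerivAt_tsum
    (g := fun (n : ℕ) θ => circlePoint (θ * (n + c)) * ((n + c : ℝ) : ℂ) ^ (-(s + 1)))
    (g' := fun (n : ℕ) θ => 2 * Real.pi * Complex.I *
      (circlePoint (θ * (n + c)) * ((n + c : ℝ) : ℂ) ^ (-s)))
    ((summable_rpow_neg_nat_add hs hc).mul_left (2 * Real.pi)) (fun n y => ?_) (fun n y => ?_)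
    (y₀ := 0) ?_ θ
  · refine ((hasDerivAt_circlePoint_mul (n + c) y).mul_const
      (((n + c : ℝ) : ℂ) ^ (-(s + 1)))).congr_deriv ?_
    have hx : ((n + c : ℝ) : ℂ) ≠ 0 := Complex.ofReal_ne_zero.mpr (by positivity)
    have : ((n + c : ℝ) : ℂ) ^ (-s) = (n + c : ℝ) * ((n + c : ℝ) : ℂ) ^ (-(s + 1)) := by
      rw [show -s = 1 + -(s + 1) by ring, Complex.cpow_add _ _ hx, Complex.cpow_one]
    rw [this]
    ring
  · rw [norm_mul, hnorm]
    simp [abs_of_pos Real.pi_pos]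
  · refine Summable.of_norm ?_
    simp only [hnorm]
    exact summable_rpow_neg_nat_add (by simp only [Complex.add_re, Complex.one_re]; linarith) hc

/-- The variation in `θ` of `e^{2πiθc} Φ(s + 1, e^{2πiθ}, c)`. Both sides are entire in `s`, and for
`1 < re s` the series may be differentiated termwise. -/
theorem circlePoint_mul_lerchPhi_sub {c θ₁ θ₂ : ℝ} (hc : 0 < c) (hle : θ₁ ≤ θ₂)
    (hθ : ∀ θ ∈ Icc θ₁ θ₂, circlePoint θ ≠ 1) (s : ℂ) :
    circlePoint (θ₂ * c) * lerchPhi (s + 1) (circlePoint θ₂) c -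
      circlePoint (θ₁ * c) * lerchPhi (s + 1) (circlePoint θ₁) c =
    ∫ θ in θ₁..θ₂, 2 * Real.pi * Complex.I *
      (circlePoint (θ * c) * lerchPhi s (circlePoint θ) c) := by
  have hdiff : ∀ θ ∈ Icc θ₁ θ₂, Differentiable ℂ fun s => lerchPhi s (circlePoint θ) c :=
    fun θ hm => differentiable_lerchPhi (norm_circlePoint θ).le (hθ θ hm) hc
  have hL : Differentiable ℂ fun s =>
      circlePoint (θ₂ * c) * lerchPhi (s + 1) (circlePoint θ₂) c -
        circlePoint (θ₁ * c) * lerchPhi (s + 1) (circlePoint θ₁) c :=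
    (((hdiff θ₂ (right_mem_Icc.mpr hle)).comp (differentiable_id.add_const 1)).const_mul _).sub
      (((hdiff θ₁ (left_mem_Icc.mpr hle)).comp (differentiable_id.add_const 1)).const_mul _)
  have hR : Differentiable ℂ fun s => ∫ θ in θ₁..θ₂, 2 * Real.pi * Complex.I *
      (circlePoint (θ * c) * lerchPhi s (circlePoint θ) c) := by
    rw [← differentiableOn_univ]
    refine differentiableOn_intervalIntegral_of_continuousOn isOpen_univ hle ?_ fun θ hm =>
      (((hdiff θ hm).const_mul _).const_mul _).differentiableOn
    have h1 := continuous_circlePoint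
    refine ContinuousOn.mul (by fun_prop) (ContinuousOn.mul (by fun_prop) ?_)
    refine continuousOn_lerchPhi.comp (f := fun q : ℂ × ℝ => (q.1, circlePoint q.2, c))
      (by fun_prop) ?_
    rintro ⟨w, θ⟩ ⟨-, hm⟩
    exact ⟨(norm_circlePoint θ).le, hθ θ hm, hc⟩
  refine congrFun (hL.eq_of_eq_of_one_lt_re hR fun w hw => ?_) s
  have hw1 : 1 < (w + 1).re := by simp only [Complex.add_re, Complex.one_re]; linarith
  have hcont : ContinuousOn (fun θ : ℝ => circlePoint (θ * c) * lerchSum w (circlePoint θ) c)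
      (uIcc θ₁ θ₂) := by
    have h1 := continuous_circlePoint
    refine ContinuousOn.mul (by fun_prop) (continuousOn_lerchSum.comp
      (f := fun θ : ℝ => (w, circlePoint θ, c)) (by fun_prop) fun θ _ => ?_)
    exact ⟨hw, (norm_circlePoint θ).le, hc⟩
  have heq : ∀ θ ∈ Icc θ₁ θ₂, ∀ v : ℂ, 1 < v.re →
      lerchPhi v (circlePoint θ) c = lerchSum v (circlePoint θ) c := fun θ hm v hv =>
    lerchPhi_eq_lerchSum hv (norm_circlePoint θ).le (hθ θ hm) hc
  rw [heq _ (right_mem_Icc.mpr hle) _ hw1, heq _ (left_mem_Icc.mpr hle) _ hw1,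
    ← intervalIntegral.integral_eq_sub_of_hasDerivAt
      (fun θ _ => hasDerivAt_circlePoint_mul_lerchSum hw hc θ)
      (hcont.const_mul _).intervalIntegrable]
  refine intervalIntegral.integral_congr fun θ hm => ?_
  rw [uIcc_of_le hle] at hm
  simp only [heq θ hm w hw]

theorem norm_circlePoint_mul_lerchPhi_sub_le {c θ₁ θ₂ M : ℝ} (hc : 0 < c)
    (hθ : ∀ θ ∈ uIcc θ₁ θ₂, circlePoint θ ≠ 1) {s : ℂ}
    (hM : ∀ θ ∈ uIcc θ₁ θ₂, ‖lerchPhi s (circlePoint θ) c‖ ≤ M) :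
    ‖circlePoint (θ₂ * c) * lerchPhi (s + 1) (circlePoint θ₂) c -
      circlePoint (θ₁ * c) * lerchPhi (s + 1) (circlePoint θ₁) c‖ ≤
    2 * Real.pi * M * |θ₂ - θ₁| := by
  wlog hle : θ₁ ≤ θ₂ generalizing θ₁ θ₂
  · rw [norm_sub_rev, abs_sub_comm]
    rw [uIcc_comm] at hθ hM
    exact this hθ hM (le_of_not_ge hle)
  have hsub : uIoc θ₁ θ₂ ⊆ uIcc θ₁ θ₂ := uIoc_subset_uIcc
  rw [circlePoint_mul_lerchPhi_sub hc hle (by rwa [uIcc_of_le hle] at hθ)]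
  refine intervalIntegral.norm_integral_le_of_norm_le_const fun θ hm => ?_
  rw [norm_mul, norm_circlePoint_mul]
  have h2 : ‖2 * (Real.pi : ℂ) * Complex.I‖ = 2 * Real.pi := by simp [abs_of_pos Real.pi_pos]
  rw [h2]
  exact mul_le_mul_of_nonneg_left (hM θ (hsub hm)) Real.two_pi_pos.le

/-- A function that is Lipschitz on `(0, δ)` has a limit at `0+`. -/
theorem exists_tendsto_nhdsGT_zero_of_lipschitz {f : ℝ → ℂ} {δ K : ℝ} (hδ : 0 < δ)
    (h : ∀ x ∈ Ioo 0 δ, ∀ y ∈ Ioo 0 δ, ‖f x - f y‖ ≤ K * |x - y|) :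
    ∃ L, Tendsto f (𝓝[>] 0) (𝓝 L) := by
  have hK : ∀ x ∈ Ioo 0 δ, ∀ y ∈ Ioo 0 δ, ‖f x - f y‖ ≤ (|K| + 1) * |x - y| := fun x hx y hy =>
    (h x hx y hy).trans (by gcongr; linarith [le_abs_self K])
  have hK0 : 0 < |K| + 1 := by positivity
  refine cauchy_map_iff_exists_tendsto.mp (Metric.cauchy_iff.mpr ⟨inferInstance, fun ε hε => ?_⟩)
  have hm : 0 < min δ (ε / (|K| + 1)) := lt_min hδ (div_pos hε hK0)
  refine ⟨f '' Ioo 0 (min δ (ε / (|K| + 1))), image_mem_map (Ioo_mem_nhdsGT hm), ?_⟩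
  rintro _ ⟨x, hx, rfl⟩ _ ⟨y, hy, rfl⟩
  rw [dist_eq_norm]
  refine (hK x ⟨hx.1, hx.2.trans_le (min_le_left _ _)⟩ y
    ⟨hy.1, hy.2.trans_le (min_le_left _ _)⟩).trans_lt ?_
  rw [← lt_div_iff₀' hK0, abs_lt]
  have := min_le_right δ (ε / (|K| + 1))
  constructor <;> linarith [hx.1, hx.2, hy.1, hy.2]

theorem circlePoint_mul_ne_one {ε x : ℝ} (hε : ε = 1 ∨ ε = -1) (hx : x ∈ Ioo 0 1) :
    circlePoint (ε * x) ≠ 1 := by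
  have hε1 : |ε| = 1 := by rcases hε with rfl | rfl <;> simp
  refine circlePoint_ne_one (fun h => ?_) ?_
  · have := congrArg abs h
    rw [abs_mul, hε1, one_mul, abs_zero, abs_of_pos hx.1] at this
    exact hx.1.ne' this
  · rw [abs_mul, hε1, one_mul, abs_of_pos hx.1]
    exact hx.2

/-- If `Φ(s, ·, c)` stays bounded as `z → 1` along one side of the unit circle, then
`Φ(s + 1, ·, c)` is Lipschitz there, up to a continuous factor, and has a limit. -/
theorem exists_tendsto_lerchPhi_add_one_of_bounded {ε c : ℝ} (hε : ε = 1 ∨ ε = -1) (hc : 0 < c)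
    {s : ℂ} {M : ℝ} (hM : ∀ᶠ x in 𝓝[>] 0, ‖lerchPhi s (circlePoint (ε * x)) c‖ ≤ M) :
    ∃ L, Tendsto (fun x => lerchPhi (s + 1) (circlePoint (ε * x)) c) (𝓝[>] 0) (𝓝 L) := by
  obtain ⟨δ', hδ', hδM⟩ := mem_nhdsGT_iff_exists_Ioo_subset.mp hM
  rw [mem_Ioi] at hδ'
  set δ := min δ' 1
  have hδ : 0 < δ := lt_min hδ' one_pos
  have hε1 : |ε| = 1 := by rcases hε with rfl | rfl <;> simp
  have hεε : ε * ε = 1 := by rcases hε with rfl | rfl <;> norm_num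
  -- Every point between `ε x` and `ε y` is `ε u` with `u` between `x` and `y`.
  have hseg : ∀ x ∈ Ioo 0 δ, ∀ y ∈ Ioo 0 δ, ∀ θ ∈ uIcc (ε * y) (ε * x),
      ∃ u ∈ Ioo 0 δ, θ = ε * u := by
    intro x hx y hy θ hθ
    refine ⟨ε * θ, ?_, by rw [← mul_assoc, hεε, one_mul]⟩
    rw [mem_uIcc] at hθ
    rcases hε with rfl | rfl <;> constructor <;> rcases hθ with h | h <;>
      linarith [hx.1, hx.2, hy.1, hy.2, h.1, h.2]
  obtain ⟨L, hL⟩ := exists_tendsto_nhdsGT_zero_of_lipschitz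
    (f := fun x => circlePoint (ε * x * c) * lerchPhi (s + 1) (circlePoint (ε * x)) c)
    (K := 2 * Real.pi * M) hδ fun x hx y hy => by
      have h := norm_circlePoint_mul_lerchPhi_sub_le (θ₁ := ε * y) (θ₂ := ε * x) (s := s) (M := M)
        hc (fun θ hθ => ?_) (fun θ hθ => ?_)
      · rwa [← mul_sub, abs_mul, hε1, one_mul] at h
      · obtain ⟨u, hu, rfl⟩ := hseg x hx y hy θ hθ
        exact circlePoint_mul_ne_one hε ⟨hu.1, hu.2.trans_le (min_le_right _ _)⟩
      · obtain ⟨u, hu, rfl⟩ := hseg x hx y hy θ hθ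
        exact hδM ⟨hu.1, hu.2.trans_le (min_le_left _ _)⟩
  refine ⟨L, ?_⟩
  have hne : ∀ θ, circlePoint θ ≠ 0 := fun θ => Complex.exp_ne_zero _
  have h1 : Tendsto (fun x : ℝ => (circlePoint (ε * x * c))⁻¹) (𝓝[>] 0) (𝓝 1) := by
    have : ContinuousAt (fun x : ℝ => (circlePoint (ε * x * c))⁻¹) 0 :=
      (continuous_circlePoint.comp (by fun_prop)).continuousAt.inv₀ (hne _)
    simpa [circlePoint_zero] using this.tendsto.mono_left (nhdsWithin_le_nhds (s := Ioi 0))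
  have h2 := h1.mul hL
  rw [one_mul] at h2
  refine h2.congr fun x => ?_
  rw [← mul_assoc, inv_mul_cancel₀ (hne _), one_mul]

/-! ### Binomial coefficients compared with powers -/

theorem norm_cpow_neg_sub_cpow_neg_le {s : ℂ} (hs : 0 ≤ s.re) {m x y : ℝ} (hm : 0 < m)
    (hx : m ≤ x) (hy : m ≤ y) :
    ‖(y : ℂ) ^ (-s) - (x : ℂ) ^ (-s)‖ ≤ ‖s‖ * m ^ (-(s.re + 1)) * |y - x| := by
  refine (convex_Ici m).norm_image_sub_le_of_norm_hasDerivWithin_le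
    (f := fun t : ℝ => (t : ℂ) ^ (-s)) (f' := fun t => -s * (t : ℂ) ^ (-s - 1)) (fun t ht => ?_)
    (fun t ht => ?_) hx hy
  · have ht0 : 0 < t := hm.trans_le ht
    have h := ((hasDerivAt_id (t : ℂ)).cpow_const (c := -s) (Or.inl (by simpa using ht0))
      ).comp_ofReal
    simpa using h.hasDerivWithinAt
  · have ht0 : 0 < t := hm.trans_le ht
    rw [norm_mul, norm_neg, Complex.norm_cpow_eq_rpow_re_of_pos ht0,
      show (-s - 1).re = -(s.re + 1) by simp; ring]
    exact mul_le_mul_of_nonneg_left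
      (Real.rpow_le_rpow_of_nonpos hm ht (by linarith)) (norm_nonneg s)

theorem norm_sub_le_of_tendsto_of_norm_sub_le {u : ℕ → ℂ} {κ : ℂ} {d : ℕ → ℝ}
    (hu : Tendsto u atTop (𝓝 κ)) (hd : Tendsto d atTop (𝓝 0))
    (h : ∀ n, ‖u (n + 1) - u n‖ ≤ d n - d (n + 1)) (n : ℕ) : ‖κ - u n‖ ≤ d n := by
  have key : ∀ m, n ≤ m → ‖u m - u n‖ ≤ d n - d m := fun m hm => by
    induction m, hm using Nat.le_induction with
    | base => simp
    | succ m _ ih =>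
      calc ‖u (m + 1) - u n‖ = ‖(u (m + 1) - u m) + (u m - u n)‖ := by ring_nf
        _ ≤ ‖u (m + 1) - u m‖ + ‖u m - u n‖ := norm_add_le _ _
        _ ≤ d n - d (m + 1) := by linarith [h m]
  have h1 : Tendsto (fun m => ‖u m - u n‖) atTop (𝓝 ‖κ - u n‖) := (hu.sub_const _).norm
  have h2 : Tendsto (fun m => d n - d m) atTop (𝓝 (d n)) := by
    simpa using hd.const_sub (d n)
  exact le_of_tendsto_of_tendsto h1 h2 (eventually_atTop.mpr ⟨n, key⟩)

/-- The coefficient of `zⁿ` in `(1 - z)^{-w}`. -/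
noncomputable def binomCoeff (w : ℂ) (n : ℕ) : ℂ :=
  (∏ j ∈ Finset.range n, (w + j)) / n.factorial

theorem binomCoeff_succ (w : ℂ) (n : ℕ) :
    binomCoeff w (n + 1) = binomCoeff w n * ((w + n) / (n + 1)) := by
  rw [binomCoeff, binomCoeff, Finset.prod_range_succ, Nat.factorial_succ, div_mul_div_comm]
  push_cast
  rw [mul_comm ((n : ℂ) + 1)]

theorem hasSum_binomCoeff (w : ℂ) {z : ℂ} (hz : ‖z‖ < 1) :
    HasSum (fun n => z ^ n * binomCoeff w n) (1 / (1 - z) ^ w) := by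
  have h := (Complex.one_div_one_sub_cpow_hasFPowerSeriesOnBall_zero w).hasSum
    (y := z) (by simpa [enorm_eq_nnnorm, ← NNReal.coe_lt_coe] using hz)
  rw [zero_add] at h
  refine h.congr_fun fun n => ?_
  have h1 : Ring.choose (w + n - 1) n = binomCoeff w n := by
    rw [binomCoeff, eq_div_iff (Nat.cast_ne_zero.mpr n.factorial_ne_zero), mul_comm,
      ← nsmul_eq_mul, Ring.choose, show w + n - 1 - n + 1 = w by ring,
      Ring.factorial_nsmul_multichoose_eq_ascPochhammer, Polynomial.ascPochhammer_smeval_eq_eval]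
    induction n with
    | zero => simp
    | succ n ih => rw [ascPochhammer_succ_eval, ih, Finset.prod_range_succ]
  simp [FormalMultilinearSeries.ofScalars, h1, mul_comm]

/-- With `x = 1 / (n + 1)` this bounds the distance from `1` of the ratio of
consecutive terms of `binomCoeff (1 - s) n * (n + 1)^s`. The derivative in `x` is
`-s (1 + s) x (1 + x)^{s - 1}`. -/
theorem norm_one_sub_mul_cpow_sub_one_le {s : ℂ} (hs : s.re ≤ 1) {x : ℝ} (hx : 0 ≤ x) :
    ‖(1 - s * x) * ((1 + x : ℝ) : ℂ) ^ s - 1‖ ≤ ‖s‖ * ‖1 + s‖ * x ^ 2 := by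
  have h := (convex_Icc 0 x).norm_image_sub_le_of_norm_hasDerivWithin_le
    (f := fun t : ℝ => (1 - s * t) * ((1 + t : ℝ) : ℂ) ^ s)
    (f' := fun t : ℝ => -(s * (1 + s)) * t * ((1 + t : ℝ) : ℂ) ^ (s - 1))
    (C := ‖s‖ * ‖1 + s‖ * x) (fun t ht => ?_) (fun t ht => ?_)
    (left_mem_Icc.mpr hx) (right_mem_Icc.mpr hx)
  · simp only [sub_zero, Complex.ofReal_zero, mul_zero, add_zero, Complex.ofReal_one,
      Complex.one_cpow, mul_one, Real.norm_eq_abs, abs_of_nonneg hx] at h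
    rwa [mul_assoc _ x x, ← sq] at h
  · have ht0 : 0 < 1 + t := by linarith [ht.1]
    have hne : (1 + t : ℂ) ≠ 0 := by
      exact_mod_cast ht0.ne'
    have h1 := (((hasDerivAt_id (t : ℂ)).const_mul s).const_sub 1).mul
      (((hasDerivAt_id (t : ℂ)).const_add 1).cpow_const (c := s) (Or.inl (by simpa using ht0)))
    have h2 := h1.comp_ofReal
    simp only [id, Pi.mul_apply, mul_one] at h2
    refine (HasDerivAt.congr_deriv (by simpa using h2) ?_).hasDerivWithinAt
    have h3 : (1 + t : ℂ) ^ s = (1 + t) * (1 + t : ℂ) ^ (s - 1) := by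
      conv_lhs => rw [show s = 1 + (s - 1) by ring, Complex.cpow_add _ _ hne, Complex.cpow_one]
    push_cast
    rw [h3]
    ring
  · have ht0 : 0 < 1 + t := by linarith [ht.1]
    rw [norm_mul, norm_mul, norm_neg, norm_mul, Complex.norm_real, Real.norm_eq_abs,
      abs_of_nonneg ht.1, Complex.norm_cpow_eq_rpow_re_of_pos ht0]
    have h1 : (1 + t) ^ (s - 1).re ≤ 1 :=
      Real.rpow_le_one_of_one_le_of_nonpos (by linarith [ht.1]) (by simpa using hs)
    calc ‖s‖ * ‖1 + s‖ * t * (1 + t) ^ (s - 1).re ≤ ‖s‖ * ‖1 + s‖ * t * 1 := by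
          gcongr
          exact mul_nonneg (by positivity) ht.1
      _ ≤ ‖s‖ * ‖1 + s‖ * x := by
          rw [mul_one]
          gcongr
          exact ht.2

theorem tendsto_binomCoeff_mul_cpow {s : ℂ} (hw : ∀ m : ℕ, 1 - s ≠ -m) :
    Tendsto (fun n : ℕ => binomCoeff (1 - s) n * ((n + 1 : ℝ) : ℂ) ^ s) atTop
      (𝓝 (Complex.Gamma (1 - s))⁻¹) := by
  rw [← tendsto_add_atTop_iff_nat 1]
  have hG := (Complex.GammaSeq_tendsto_Gamma (1 - s)).inv₀ (Complex.Gamma_ne_zero hw)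
  have h1 : Tendsto (fun n : ℕ => ((((n : ℝ) / (n + 1) : ℝ)) : ℂ) *
      ((1 + 2 / (n : ℝ) : ℝ) : ℂ) ^ s) atTop (𝓝 1) := by
    have ha : Tendsto (fun n : ℕ => ((((n : ℝ) / (n + 1) : ℝ)) : ℂ)) atTop (𝓝 1) := by
      exact_mod_cast (Complex.continuous_ofReal.tendsto 1).comp
        (tendsto_natCast_div_add_atTop (1 : ℝ))
    have hb : Tendsto (fun n : ℕ => ((1 + 2 / (n : ℝ) : ℝ) : ℂ) ^ s) atTop (𝓝 1) := by
      have h2 : Tendsto (fun n : ℕ => 1 + 2 / (n : ℝ)) atTop (𝓝 1) := by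
        simpa using (tendsto_const_div_atTop_nhds_zero_nat (2 : ℝ)).const_add 1
      have h3 : ContinuousAt (fun x : ℝ => (x : ℂ) ^ s) 1 :=
        ContinuousAt.cpow (by fun_prop) (by fun_prop) (by simp)
      simpa [Function.comp_def] using h3.tendsto.comp h2
    simpa using ha.mul hb
  have h2 := h1.mul hG
  rw [one_mul] at h2
  refine h2.congr' ?_
  filter_upwards [eventually_gt_atTop 0] with n hn
  have hn0 : (0 : ℝ) < n := Nat.cast_pos.mpr hn
  have hnC : (n : ℂ) ≠ 0 := Nat.cast_ne_zero.mpr hn.ne'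
  have hn1 : (n : ℂ) + 1 ≠ 0 := by exact_mod_cast n.succ_ne_zero
  have hf : (n.factorial : ℂ) ≠ 0 := Nat.cast_ne_zero.mpr n.factorial_ne_zero
  have hns : (n : ℂ) ^ s ≠ 0 := by simp [Complex.cpow_eq_zero_iff, hnC]
  have h3 : (((n + 1 : ℕ) + 1 : ℝ) : ℂ) ^ s = (n : ℂ) ^ s * ((1 + 2 / (n : ℝ) : ℝ) : ℂ) ^ s := by
    rw [← Complex.ofReal_natCast, ← Complex.mul_cpow_ofReal_nonneg hn0.le (by positivity),
      ← Complex.ofReal_mul]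
    congr 2
    push_cast
    field_simp
    ring
  rw [h3, Complex.GammaSeq, binomCoeff, Nat.factorial_succ, Complex.cpow_sub _ _ hnC,
    Complex.cpow_one, inv_div]
  push_cast
  field_simp

theorem one_sub_ne_neg_natCast {s : ℂ} (hs : s.re ≤ 1) (hne : s ≠ 1) (m : ℕ) : 1 - s ≠ -m := by
  intro hm
  have h1 : s = 1 + m := by linear_combination -hm
  rw [h1, Complex.add_re, Complex.one_re, Complex.natCast_re] at hs
  have h2 : (m : ℝ) ≤ 0 := by linarith
  have h3 : m = 0 := Nat.le_zero.mp (by exact_mod_cast h2)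
  exact hne (by rw [h1, h3, Nat.cast_zero, add_zero])

/-- The normalized coefficients `uₙ = binomCoeff (1 - s) n * (n + 1)^s` tend to `1 / Γ(1 - s)`, and
`uₙ₊₁ - uₙ = O(n⁻²)`, so the limit is approached at the rate `O(n⁻¹)`. -/
theorem summable_binomCoeff_sub {s : ℂ} (hs : 0 < s.re) (hs1 : s.re ≤ 1) (hne : s ≠ 1) :
    Summable fun n : ℕ => Complex.Gamma (1 - s) * binomCoeff (1 - s) n -
      ((n + 1 : ℝ) : ℂ) ^ (-s) := by
  have hw := one_sub_ne_neg_natCast hs1 hne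
  have hΓ := Complex.Gamma_ne_zero hw
  set κ := (Complex.Gamma (1 - s))⁻¹
  set u : ℕ → ℂ := fun n => binomCoeff (1 - s) n * ((n + 1 : ℝ) : ℂ) ^ s with hu
  have hlim : Tendsto u atTop (𝓝 κ) := tendsto_binomCoeff_mul_cpow hw
  obtain ⟨M, hM⟩ : ∃ M, ∀ n, ‖u n‖ ≤ M := by
    obtain ⟨M, hM⟩ := (Metric.isBounded_range_of_tendsto u hlim).exists_norm_le
    exact ⟨M, fun n => hM _ (mem_range_self n)⟩
  have hM0 : 0 ≤ M := (norm_nonneg _).trans (hM 0)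
  set C := M * (‖s‖ * ‖1 + s‖)
  have hC : 0 ≤ C := by positivity
  have hstep : ∀ n : ℕ, ‖u (n + 1) - u n‖ ≤ 2 * C / (n + 1) - 2 * C / ((n + 1 : ℕ) + 1) := by
    intro n
    have hn : (0 : ℝ) < (n : ℝ) + 1 := by positivity
    have hnC : (n : ℂ) + 1 ≠ 0 := by exact_mod_cast n.succ_ne_zero
    have h1 : u (n + 1) - u n = u n *
        ((1 - s * ((1 / ((n : ℝ) + 1) : ℝ) : ℂ)) * ((1 + 1 / ((n : ℝ) + 1) : ℝ) : ℂ) ^ s - 1) := by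
      have h2 : (((n + 1 : ℕ) + 1 : ℝ) : ℂ) ^ s =
          ((n + 1 : ℝ) : ℂ) ^ s * ((1 + 1 / ((n : ℝ) + 1) : ℝ) : ℂ) ^ s := by
        rw [← Complex.mul_cpow_ofReal_nonneg hn.le (by positivity), ← Complex.ofReal_mul]
        congr 2
        push_cast
        field_simp
      simp only [hu]
      rw [h2, binomCoeff_succ]
      push_cast
      field_simp
      ring
    rw [h1, norm_mul]
    calc ‖u n‖ * _ ≤ M * (‖s‖ * ‖1 + s‖ * (1 / ((n : ℝ) + 1)) ^ 2) :=
          mul_le_mul (hM n) (norm_one_sub_mul_cpow_sub_one_le hs1 (by positivity))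
            (norm_nonneg _) hM0
      _ = C * (1 / ((n : ℝ) + 1)) ^ 2 := by ring
      _ ≤ C * (2 / (n + 1) - 2 / ((n + 1 : ℕ) + 1)) := by
          gcongr
          push_cast
          rw [div_sub_div _ _ (by positivity) (by positivity), div_pow, div_le_div_iff₀
            (by positivity) (by positivity)]
          nlinarith [n.cast_nonneg (α := ℝ)]
      _ = _ := by ring
  have hd : Tendsto (fun n : ℕ => 2 * C / ((n : ℝ) + 1)) atTop (𝓝 0) :=
    tendsto_const_nhds.div_atTop (tendsto_natCast_atTop_atTop.atTop_add tendsto_const_nhds)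
  have hrate := norm_sub_le_of_tendsto_of_norm_sub_le hlim hd hstep
  refine ((summable_nat_add_one_rpow_neg (show 1 < s.re + 1 by linarith)).mul_left
    (‖Complex.Gamma (1 - s)‖ * (2 * C))).of_norm_bounded fun n => ?_
  have hn : (0 : ℝ) < (n : ℝ) + 1 := by positivity
  have hnC : ((n + 1 : ℝ) : ℂ) ≠ 0 := Complex.ofReal_ne_zero.mpr hn.ne'
  have h1 : Complex.Gamma (1 - s) * binomCoeff (1 - s) n - ((n + 1 : ℝ) : ℂ) ^ (-s) =
      Complex.Gamma (1 - s) * ((u n - κ) * ((n + 1 : ℝ) : ℂ) ^ (-s)) := by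
    have h2 : ((n + 1 : ℝ) : ℂ) ^ s * ((n + 1 : ℝ) : ℂ) ^ (-s) = 1 := by
      rw [← Complex.cpow_add _ _ hnC, add_neg_cancel, Complex.cpow_zero]
    have h3 : Complex.Gamma (1 - s) * κ = 1 := mul_inv_cancel₀ hΓ
    simp only [hu]
    linear_combination (-Complex.Gamma (1 - s) * binomCoeff (1 - s) n) * h2 +
      ((n + 1 : ℝ) : ℂ) ^ (-s) * h3
  rw [h1, norm_mul, norm_mul, norm_sub_rev, Complex.norm_cpow_eq_rpow_re_of_pos hn, mul_assoc]
  refine mul_le_mul_of_nonneg_left ?_ (norm_nonneg _)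
  calc ‖κ - u n‖ * ((n : ℝ) + 1) ^ (-s).re
      ≤ 2 * C / (n + 1) * ((n : ℝ) + 1) ^ (-s).re := by gcongr; exact hrate n
    _ = 2 * C * ((n : ℝ) + 1) ^ (-(s.re + 1)) := by
        rw [show -(s.re + 1) = (-s).re - 1 by simp; ring, Real.rpow_sub_one hn.ne']
        ring

theorem summable_cpow_neg_sub {s : ℂ} (hs : 0 < s.re) {c c' : ℝ} (hc : 0 < c) (hc' : 0 < c') :
    Summable fun n : ℕ => ((n + c' : ℝ) : ℂ) ^ (-s) - ((n + c : ℝ) : ℂ) ^ (-s) := by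
  have hm : 0 < min c c' := lt_min hc hc'
  refine ((summable_rpow_neg_nat_add (show 1 < s.re + 1 by linarith) hm).mul_left
    (‖s‖ * |c' - c|)).of_norm_bounded fun n => ?_
  have h := norm_cpow_neg_sub_cpow_neg_le hs.le (m := n + min c c') (x := n + c) (y := n + c')
    (by positivity) (by gcongr; exact min_le_left _ _) (by gcongr; exact min_le_right _ _)
  rw [add_sub_add_left_eq_sub] at h
  linarith

/-! ### Behaviour of the continuation near `z = 1` -/

/-- If the coefficients `bₙ` of `B(z)` differ from `(n + c)^{-s}` by a summable sequence, then `B`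
and `Φ(s, ·, c)` differ by a continuous function on the closed unit disc; on the unit circle this
holds by continuity, where neither series need converge. -/
theorem exists_continuousOn_sub_lerchPhi {s : ℂ} {c : ℝ} (hs : 0 < s.re) (hc : 0 < c)
    {b : ℕ → ℂ} {B : ℂ → ℂ} (hB : ContinuousOn B {z | ‖z‖ ≤ 1 ∧ z ≠ 1})
    (hsum : ∀ z : ℂ, ‖z‖ < 1 → HasSum (fun n => z ^ n * b n) (B z))
    (hb : Summable fun n : ℕ => b n - ((n + c : ℝ) : ℂ) ^ (-s)) :
    ∃ R : ℂ → ℂ, ContinuousOn R (Metric.closedBall 0 1) ∧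
      ∀ z : ℂ, ‖z‖ ≤ 1 → z ≠ 1 → B z - lerchPhi s z c = R z := by
  set R : ℂ → ℂ := fun z => ∑' n : ℕ, z ^ n * (b n - ((n + c : ℝ) : ℂ) ^ (-s))
  have hR : ContinuousOn R (Metric.closedBall 0 1) := by
    refine continuousOn_tsum (fun n => by fun_prop) hb.norm fun n z hz => ?_
    rw [norm_mul, norm_pow]
    exact mul_le_of_le_one_left (norm_nonneg _)
      (pow_le_one₀ (norm_nonneg z) (by simpa using hz))
  refine ⟨R, hR, ?_⟩
  have hΦ : ContinuousOn (fun z => lerchPhi s z c) {z | ‖z‖ ≤ 1 ∧ z ≠ 1} :=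
    continuousOn_lerchPhi.comp (f := fun z : ℂ => (s, z, c)) (by fun_prop)
      fun z hz => ⟨hz.1, hz.2, hc⟩
  have heq : EqOn (fun z => B z - lerchPhi s z c) R (Metric.ball 0 1) := fun z hz => by
    have hz1 : ‖z‖ < 1 := by simpa using hz
    have h1 := (hsum z hz1).sub (summable_lerch_of_norm_lt_one hs.le hz1 hc).hasSum
    simp only [← mul_sub] at h1
    simp only [lerchPhi_eq_lerchSum_of_norm_lt_one hs hz1 hc]
    exact h1.tsum_eq.symm
  have hD := heq.of_subset_closure (t := {z | ‖z‖ ≤ 1 ∧ z ≠ 1}) (hB.sub hΦ)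
    (hR.mono fun z hz => by simpa using hz.1) (fun z hz => ?_) fun z hz => ?_
  · exact fun z hz hz1 => hD ⟨hz, hz1⟩
  · have hz1 : ‖z‖ < 1 := by simpa using hz
    refine ⟨hz1.le, ?_⟩
    rintro rfl
    simp at hz1
  · rw [closure_ball _ one_ne_zero]
    simpa using hz.1

theorem tendsto_circlePoint_mul (ε : ℝ) :
    Tendsto (fun x : ℝ => circlePoint (ε * x)) (𝓝[>] 0) (𝓝 1) := by
  have : ContinuousAt (fun x : ℝ => circlePoint (ε * x)) 0 :=
    (continuous_circlePoint.comp (by fun_prop)).continuousAt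
  simpa [circlePoint_zero] using this.tendsto.mono_left (nhdsWithin_le_nhds (s := Ioi 0))

theorem exists_tendsto_of_tendsto_lerchPhi {s : ℂ} {c : ℝ} (hs : 0 < s.re) (hc : 0 < c)
    {b : ℕ → ℂ} {B : ℂ → ℂ} (hB : ContinuousOn B {z | ‖z‖ ≤ 1 ∧ z ≠ 1})
    (hsum : ∀ z : ℂ, ‖z‖ < 1 → HasSum (fun n => z ^ n * b n) (B z))
    (hb : Summable fun n : ℕ => b n - ((n + c : ℝ) : ℂ) ^ (-s)) {ε : ℝ} (hε : ε = 1 ∨ ε = -1)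
    {L : ℂ} (hL : Tendsto (fun x => lerchPhi s (circlePoint (ε * x)) c) (𝓝[>] 0) (𝓝 L)) :
    ∃ L', Tendsto (fun x => B (circlePoint (ε * x))) (𝓝[>] 0) (𝓝 L') := by
  obtain ⟨R, hR, h⟩ := exists_continuousOn_sub_lerchPhi hs hc hB hsum hb
  have h1 : Tendsto (fun x => R (circlePoint (ε * x))) (𝓝[>] 0) (𝓝 (R 1)) :=
    (hR 1 (by simp)).tendsto.comp (tendsto_nhdsWithin_iff.mpr ⟨tendsto_circlePoint_mul ε,
      Eventually.of_forall fun x => by simp [norm_circlePoint]⟩)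
  refine ⟨R 1 + L, (h1.add hL).congr' ?_⟩
  filter_upwards [Ioo_mem_nhdsGT (zero_lt_one' ℝ)] with x hx
  rw [← h _ (norm_circlePoint _).le (circlePoint_mul_ne_one hε hx), sub_add_cancel]

/-- If `x^w` had a limit `L` at `0+`, then `L = λ^w L` for all `λ > 0`, while `‖L‖ ≥ 1`. -/
theorem not_tendsto_cpow_nhdsGT_zero {w : ℂ} (hw : w.re ≤ 0) (hw0 : w ≠ 0) (L : ℂ) :
    ¬ Tendsto (fun x : ℝ => (x : ℂ) ^ w) (𝓝[>] 0) (𝓝 L) := by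
  intro h
  have hL : 1 ≤ ‖L‖ := by
    refine ge_of_tendsto h.norm ?_
    filter_upwards [Ioo_mem_nhdsGT (zero_lt_one' ℝ)] with x hx
    rw [Complex.norm_cpow_eq_rpow_re_of_pos hx.1]
    exact Real.one_le_rpow_of_pos_of_le_one_of_nonpos hx.1 hx.2.le hw
  have hL0 : L ≠ 0 := by
    rintro rfl
    norm_num at hL
  have hexp : ∀ t : ℝ, Complex.exp (t * w) = 1 := by
    intro t
    have hpos : 0 < Real.exp t := Real.exp_pos t
    have hm : Tendsto (fun x : ℝ => Real.exp t * x) (𝓝[>] 0) (𝓝[>] 0) := by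
      refine tendsto_nhdsWithin_iff.mpr ⟨?_, ?_⟩
      · have : Continuous fun x : ℝ => Real.exp t * x := by fun_prop
        simpa using (this.tendsto 0).mono_left (nhdsWithin_le_nhds (s := Ioi 0))
      · filter_upwards [self_mem_nhdsWithin] with x hx using mul_pos hpos hx
    have h1 : Tendsto (fun x : ℝ => Complex.exp (t * w) * (x : ℂ) ^ w) (𝓝[>] 0) (𝓝 L) := by
      refine (h.comp hm).congr' ?_
      filter_upwards [self_mem_nhdsWithin] with x hx
      simp only [Function.comp]
      rw [Complex.ofReal_mul, Complex.mul_cpow_ofReal_nonneg hpos.le (le_of_lt hx),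
        Complex.cpow_def_of_ne_zero (Complex.ofReal_ne_zero.mpr hpos.ne'), ← Complex.ofReal_log
          hpos.le, Real.log_exp]
    have h2 := tendsto_nhds_unique h1 (h.const_mul (Complex.exp (t * w)))
    exact mul_right_cancel₀ hL0 (by rw [one_mul, ← h2])
  have hd : HasDerivAt (fun t : ℝ => Complex.exp (t * w)) w 0 := by
    have := ((hasDerivAt_id ((0 : ℝ) : ℂ)).mul_const w).cexp.comp_ofReal
    simpa using this
  simp only [hexp] at hd
  exact hw0 (hd.unique (hasDerivAt_const 0 1))

/-- `1 - e^{2πiεx} = x q(x)` with `q` close to `-2πiε`, which is off the branch cut of `log`. -/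
theorem tendsto_one_sub_circlePoint_div (ε : ℝ) :
    Tendsto (fun x : ℝ => (1 - circlePoint (ε * x)) / x) (𝓝[>] 0)
      (𝓝 (-(2 * Real.pi * Complex.I * ε))) := by
  have h := hasDerivAt_iff_tendsto_slope.mp (hasDerivAt_circlePoint_mul ε 0)
  have h1 := (h.mono_left (nhdsWithin_mono 0 fun x (hx : 0 < x) => hx.ne')).neg
  simp only [zero_mul, circlePoint_zero, mul_one] at h1
  refine h1.congr fun x => ?_
  simp only [slope, vsub_eq_sub, sub_zero, zero_mul, circlePoint_zero, mul_comm x ε]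
  rw [Complex.real_smul, Complex.ofReal_inv]
  ring

theorem not_tendsto_one_sub_circlePoint_cpow {w : ℂ} (hw : w.re ≤ 0) (hw0 : w ≠ 0) {ε : ℝ}
    (hε : ε = 1 ∨ ε = -1) (L : ℂ) :
    ¬ Tendsto (fun x : ℝ => (1 - circlePoint (ε * x)) ^ w) (𝓝[>] 0) (𝓝 L) := by
  intro h
  have hne : -(2 * (Real.pi : ℂ) * Complex.I * ε) ≠ 0 := by
    rcases hε with rfl | rfl <;> simp [Real.pi_ne_zero]
  have hslit : -(2 * (Real.pi : ℂ) * Complex.I * ε) ∈ Complex.slitPlane := by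
    right
    rcases hε with rfl | rfl <;> simp [Real.pi_ne_zero]
  have hq := tendsto_one_sub_circlePoint_div ε
  have hqw : Tendsto (fun x : ℝ => ((1 - circlePoint (ε * x)) / x) ^ w) (𝓝[>] 0)
      (𝓝 ((-(2 * Real.pi * Complex.I * ε)) ^ w)) :=
    (ContinuousAt.cpow continuousAt_id continuousAt_const hslit).tendsto.comp hq
  have hne' : (-(2 * (Real.pi : ℂ) * Complex.I * ε)) ^ w ≠ 0 := by
    rw [Ne, Complex.cpow_eq_zero_iff]
    exact fun h => hne h.1
  refine not_tendsto_cpow_nhdsGT_zero hw hw0 _ ((h.div hqw hne').congr' ?_)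
  filter_upwards [Ioo_mem_nhdsGT (zero_lt_one' ℝ)] with x hx
  have hx0 : (x : ℂ) ≠ 0 := Complex.ofReal_ne_zero.mpr hx.1.ne'
  have hz : 1 - circlePoint (ε * x) ≠ 0 := sub_ne_zero.mpr (circlePoint_mul_ne_one hε hx).symm
  have hq0 : (1 - circlePoint (ε * x)) / x ≠ 0 := div_ne_zero hz hx0
  have hmul : (1 - circlePoint (ε * x)) ^ w =
      (x : ℂ) ^ w * ((1 - circlePoint (ε * x)) / x) ^ w := by
    conv_lhs => rw [← mul_div_cancel₀ (1 - circlePoint (ε * x)) hx0]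
    rw [Complex.cpow_def_of_ne_zero (mul_ne_zero hx0 hq0), Complex.cpow_def_of_ne_zero hx0,
      Complex.cpow_def_of_ne_zero hq0, Complex.log_ofReal_mul hx.1 hq0,
      Complex.ofReal_log hx.1.le, add_mul, Complex.exp_add]
  have hqw0 : ((1 - circlePoint (ε * x)) / x) ^ w ≠ 0 := by
    rw [Ne, Complex.cpow_eq_zero_iff]
    exact fun h => hq0 h.1
  rw [Pi.div_apply, hmul, mul_div_cancel_right₀ _ hqw0]

theorem one_sub_mem_slitPlane {z : ℂ} (hz : ‖z‖ ≤ 1) (hz1 : z ≠ 1) :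
    1 - z ∈ Complex.slitPlane := by
  left
  have h1 : z.re ≤ 1 := (Complex.re_le_norm z).trans hz
  rcases h1.lt_or_eq with h | h
  · simpa using h
  · exfalso
    have h2 : z.re ^ 2 + z.im ^ 2 ≤ 1 := by
      have := Complex.sq_norm z
      rw [Complex.normSq_apply] at this
      nlinarith [norm_nonneg z]
    have h3 : z.im = 0 := by
      rw [h] at h2
      nlinarith [sq_nonneg z.im]
    exact hz1 (Complex.ext (by simpa using h) (by simpa using h3))

/-- For `s ≠ 1` in the strip the singularity at `z = 1` is that of the binomial series
`Γ(1 - s) (1 - z)^{s - 1}`. -/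
theorem not_tendsto_lerchPhi_strip {s : ℂ} (hs : 0 < s.re) (hs1 : s.re ≤ 1) (hne : s ≠ 1) {c : ℝ}
    (hc : 0 < c) {ε : ℝ} (hε : ε = 1 ∨ ε = -1) (L : ℂ) :
    ¬ Tendsto (fun x => lerchPhi s (circlePoint (ε * x)) c) (𝓝[>] 0) (𝓝 L) := by
  intro hL
  have hΓ := Complex.Gamma_ne_zero (one_sub_ne_neg_natCast hs1 hne)
  have hlim := exists_tendsto_of_tendsto_lerchPhi hs hc
    (b := fun n => Complex.Gamma (1 - s) * binomCoeff (1 - s) n)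
    (B := fun z => Complex.Gamma (1 - s) * (1 - z) ^ (s - 1)) ?_ (fun z hz => ?_) ?_ hε hL
  · obtain ⟨L', hL'⟩ := hlim
    refine not_tendsto_one_sub_circlePoint_cpow (w := s - 1) (by simpa using hs1)
      (sub_ne_zero.mpr hne) hε _ ((hL'.const_mul (Complex.Gamma (1 - s))⁻¹).congr fun x => ?_)
    rw [inv_mul_cancel_left₀ hΓ]
  · exact continuousOn_const.mul (ContinuousOn.cpow (by fun_prop) (by fun_prop)
      fun z hz => one_sub_mem_slitPlane hz.1 hz.2)
  · have h := (hasSum_binomCoeff (1 - s) hz).mul_left (Complex.Gamma (1 - s))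
    rw [one_div, ← Complex.cpow_neg, neg_sub] at h
    exact h.congr_fun fun n => by ring
  · refine ((summable_binomCoeff_sub hs hs1 hne).sub
      (summable_cpow_neg_sub hs one_pos hc)).congr fun n => ?_
    ring

/-- At `s = 1` the singularity at `z = 1` is that of `-log (1 - z)`. -/
theorem not_tendsto_lerchPhi_one {c : ℝ} (hc : 0 < c) {ε : ℝ} (hε : ε = 1 ∨ ε = -1) (L : ℂ) :
    ¬ Tendsto (fun x => lerchPhi 1 (circlePoint (ε * x)) c) (𝓝[>] 0) (𝓝 L) := by
  intro hL
  have hlim := exists_tendsto_of_tendsto_lerchPhi (by simp) hc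
    (b := fun n => 1 / (n : ℂ)) (B := fun z => -Complex.log (1 - z)) ?_ (fun z hz => ?_) ?_ hε hL
  · obtain ⟨L', hL'⟩ := hlim
    have h1 : Tendsto (fun x => ‖1 - circlePoint (ε * x)‖) (𝓝[>] 0) (𝓝[>] 0) := by
      refine tendsto_nhdsWithin_iff.mpr ⟨?_, ?_⟩
      · simpa using ((tendsto_circlePoint_mul ε).const_sub 1).norm
      · filter_upwards [Ioo_mem_nhdsGT (zero_lt_one' ℝ)] with x hx
        exact norm_pos_iff.mpr (sub_ne_zero.mpr (circlePoint_mul_ne_one hε hx).symm)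
    have h2 := Real.tendsto_log_nhdsGT_zero.comp h1
    have h3 := (Complex.continuous_re.tendsto _).comp hL'.neg
    simp only [Function.comp_def, neg_neg, Complex.log_re] at h2 h3
    exact not_tendsto_nhds_of_tendsto_atBot h2 _ h3
  · exact (ContinuousOn.clog (by fun_prop) fun z hz => one_sub_mem_slitPlane hz.1 hz.2).neg
  · exact (Complex.hasSum_taylorSeries_neg_log hz).congr_fun fun n => by ring
  · rw [← summable_nat_add_iff 1]
    refine (summable_cpow_neg_sub (s := 1) (by simp) (c := c + 1) (c' := 1) (by linarith)
      one_pos).congr fun n => ?_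
    simp only [Complex.cpow_neg_one]
    push_cast
    ring_nf

/-- At a fixed `c`, the continuation has no limit at `z = 1` along either side of the unit
circle when `re s ≤ 1`: a limit at `s` with `re s ≤ 0` would yield one at `s + 1`. -/
theorem not_tendsto_lerchPhi {s : ℂ} (hs : s.re ≤ 1) {c : ℝ} (hc : 0 < c) {ε : ℝ}
    (hε : ε = 1 ∨ ε = -1) (L : ℂ) :
    ¬ Tendsto (fun x => lerchPhi s (circlePoint (ε * x)) c) (𝓝[>] 0) (𝓝 L) := by
  obtain ⟨k, hk⟩ := exists_nat_gt (-s.re)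
  induction k generalizing s L with
  | zero =>
    have hs0 : 0 < s.re := by simpa using hk
    rcases eq_or_ne s 1 with rfl | hne
    · exact not_tendsto_lerchPhi_one hc hε L
    · exact not_tendsto_lerchPhi_strip hs0 hs hne hc hε L
  | succ k ih =>
    intro hL
    rcases lt_or_ge 0 s.re with hs0 | hs0
    · exact ih hs L (by linarith [k.cast_nonneg (α := ℝ)]) hL
    · obtain ⟨L', hL'⟩ := exists_tendsto_lerchPhi_add_one_of_bounded hε hc
        (hL.norm.eventually_le_const (lt_add_one _))
      refine ih (s := s + 1) ?_ L' ?_ hL'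
      · simpa using hs0
      · push_cast at hk
        simp only [Complex.add_re, Complex.one_re]
        linarith

theorem not_eventually_norm_lerchPhi_le {s : ℂ} (hs : s.re ≤ 0) {c : ℝ} (hc : 0 < c) {ε : ℝ}
    (hε : ε = 1 ∨ ε = -1) (M : ℝ) :
    ¬ ∀ᶠ x in 𝓝[>] 0, ‖lerchPhi s (circlePoint (ε * x)) c‖ ≤ M := by
  intro hM
  obtain ⟨L, hL⟩ := exists_tendsto_lerchPhi_add_one_of_bounded hε hc hM
  exact not_tendsto_lerchPhi (by simpa using hs) hc hε L hL

/-! ### Limits of the Lerch zeta function at the boundary of the square -/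

theorem closure_openSquare : closure openSquare = Icc 0 1 ×ˢ Icc 0 1 := by
  rw [openSquare, closure_prod_eq, closure_Ioo zero_ne_one]

theorem mem_frontier_openSquare {p : ℝ × ℝ} (hp : p ∈ frontier openSquare) :
    p ∈ Icc (0 : ℝ) 1 ×ˢ Icc (0 : ℝ) 1 ∧ p ∉ openSquare := by
  have ho : IsOpen openSquare := isOpen_Ioo.prod isOpen_Ioo
  rwa [ho.frontier_eq, closure_openSquare] at hp

theorem tendsto_lerchZeta_of_one_lt_re {s : ℂ} (hs : 1 < s.re) {p : ℝ × ℝ} (hc : 0 < p.2)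
    (hc1 : p.2 ≤ 1) : Tendsto (fun q : ℝ × ℝ => lerchZeta s q.1 q.2) (𝓝[openSquare] p)
      (𝓝 (extLerchZeta s p.1 p.2)) := by
  rw [extLerchZeta_of_one_lt_re hs hc hc1]
  have hcont : ContinuousOn (fun q : ℝ × ℝ => lerchSum s (circlePoint q.1) q.2) {q | 0 < q.2} := by
    have h1 := continuous_circlePoint
    exact continuousOn_lerchSum.comp (f := fun q : ℝ × ℝ => (s, circlePoint q.1, q.2))
      (by fun_prop) fun q hq => ⟨hs, (norm_circlePoint _).le, hq⟩
  have h := ((hcont p hc).mono fun q (hq : q ∈ openSquare) => hq.2.1).tendsto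
  refine h.congr' ?_
  filter_upwards [self_mem_nhdsWithin] with q hq
  rw [lerchZeta, merContinuation_of_one_lt_re _ hs, lerchSeries_eq_lerchSum]

theorem continuousOn_lerchPhi_circlePoint (s : ℂ) :
    ContinuousOn (fun q : ℝ × ℝ => lerchPhi s (circlePoint q.1) q.2) (Ioo 0 1 ×ˢ Ioi 0) := by
  have h1 := continuous_circlePoint
  exact continuousOn_lerchPhi.comp (f := fun q : ℝ × ℝ => (s, circlePoint q.1, q.2))
    (by fun_prop) fun q hq => ⟨(norm_circlePoint _).le, circlePoint_ne_one_of_mem_Ioo hq.1, hq.2⟩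

/-- The limit at interior points and on the edge `c = 1`, for all `s`. -/
theorem tendsto_lerchZeta_of_pos_right (s : ℂ) {p : ℝ × ℝ} (ha : p.1 ∈ Ioo 0 1) (hc : 0 < p.2)
    (hc1 : p.2 ≤ 1) : Tendsto (fun q : ℝ × ℝ => lerchZeta s q.1 q.2) (𝓝[openSquare] p)
      (𝓝 (extLerchZeta s p.1 p.2)) := by
  rw [extLerchZeta_eq_lerchPhi ha hc hc1]
  have h := ((continuousOn_lerchPhi_circlePoint s p ⟨ha, hc⟩).mono
    fun q (hq : q ∈ openSquare) => ⟨hq.1, hq.2.1⟩).tendsto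
  refine h.congr' ?_
  filter_upwards [self_mem_nhdsWithin] with q hq
  rw [lerchZeta_eq_lerchPhi hq.1 hq.2.1]

theorem lerchZeta_eq_cpow_add (s : ℂ) {q : ℝ × ℝ} (hq : q ∈ openSquare) :
    lerchZeta s q.1 q.2 =
      (q.2 : ℂ) ^ (-s) + circlePoint q.1 * lerchPhi s (circlePoint q.1) (q.2 + 1) := by
  rw [lerchZeta_eq_lerchPhi hq.1 hq.2.1]
  exact lerchPhi_eq_cpow_add (norm_circlePoint _).le (circlePoint_ne_one_of_mem_Ioo hq.1) hq.2.1 s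

theorem tendsto_circlePoint_mul_lerchPhi_add_one (s : ℂ) {a : ℝ} (ha : a ∈ Ioo 0 1) :
    Tendsto (fun q : ℝ × ℝ => circlePoint q.1 * lerchPhi s (circlePoint q.1) (q.2 + 1))
      (𝓝[openSquare] (a, 0)) (𝓝 (extLerchZeta s a 0)) := by
  rw [extLerchZeta_zero_right ha]
  have h1 := continuous_circlePoint
  have hcont : ContinuousOn
      (fun q : ℝ × ℝ => circlePoint q.1 * lerchPhi s (circlePoint q.1) (q.2 + 1))
      (Ioo 0 1 ×ˢ Ici 0) := by
    refine ContinuousOn.mul (by fun_prop) ((continuousOn_lerchPhi_circlePoint s).comp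
      (f := fun q : ℝ × ℝ => (q.1, q.2 + 1)) (by fun_prop) fun q hq => ⟨hq.1, ?_⟩)
    exact add_pos_of_nonneg_of_pos (show 0 ≤ q.2 from hq.2) one_pos
  have h := ((hcont (a, 0) ⟨ha, le_refl (0 : ℝ)⟩).mono
    fun q (hq : q ∈ openSquare) => ⟨hq.1, hq.2.1.le⟩).tendsto
  simpa using h

theorem tendsto_lerchZeta_zero_right {s : ℂ} {a : ℝ} (ha : a ∈ Ioo 0 1) {l : ℂ}
    (hl : Tendsto (fun x : ℝ => (x : ℂ) ^ (-s)) (𝓝[>] 0) (𝓝 l)) :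
    Tendsto (fun q : ℝ × ℝ => lerchZeta s q.1 q.2) (𝓝[openSquare] (a, 0))
      (𝓝 (extLerchZeta s a 0 + l)) := by
  have hsnd : Tendsto (fun q : ℝ × ℝ => q.2) (𝓝[openSquare] (a, 0)) (𝓝[>] 0) := by
    refine tendsto_nhdsWithin_iff.mpr ⟨?_, ?_⟩
    · exact (continuous_snd.tendsto _).mono_left nhdsWithin_le_nhds
    · filter_upwards [self_mem_nhdsWithin] with q hq using hq.2.1
  rw [add_comm]
  refine ((hl.comp hsnd).add (tendsto_circlePoint_mul_lerchPhi_add_one s ha)).congr' ?_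
  filter_upwards [self_mem_nhdsWithin] with q hq
  exact (lerchZeta_eq_cpow_add s hq).symm

theorem tendsto_cpow_nhdsGT_zero {w : ℂ} (hw : 0 < w.re) :
    Tendsto (fun x : ℝ => (x : ℂ) ^ w) (𝓝[>] 0) (𝓝 0) := by
  have h := (Complex.continuousAt_ofReal_cpow_const 0 w (Or.inl hw)).tendsto
  rw [Complex.ofReal_zero, Complex.zero_cpow (fun h => by simp [h] at hw)] at h
  exact h.mono_left nhdsWithin_le_nhds

theorem tendsto_lerchZeta_of_mem_extensionPoints {s : ℂ} {p : ℝ × ℝ}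
    (hp : p ∈ extensionPoints s) : Tendsto (fun q : ℝ × ℝ => lerchZeta s q.1 q.2)
      (𝓝[openSquare] p) (𝓝 (extLerchZeta s p.1 p.2)) := by
  rcases hp with ⟨-, hc, hs⟩ | ⟨-, hc, hs⟩ | ⟨hc, ha, hs⟩ | ⟨hc, ha⟩ | ⟨rfl | rfl, hs⟩
  · exact tendsto_lerchZeta_of_one_lt_re hs hc.1 hc.2.le
  · exact tendsto_lerchZeta_of_one_lt_re hs hc.1 hc.2.le
  · obtain ⟨a, c⟩ := p
    obtain rfl : c = 0 := hc
    simpa using tendsto_lerchZeta_zero_right ha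
      (tendsto_cpow_nhdsGT_zero (w := -s) (by simpa using hs))
  · exact tendsto_lerchZeta_of_pos_right s ha (by rw [hc]; exact one_pos) hc.le
  · exact tendsto_lerchZeta_of_one_lt_re hs one_pos le_rfl
  · exact tendsto_lerchZeta_of_one_lt_re hs one_pos le_rfl

theorem tendsto_lerchZeta_of_mem_exceptionalPoints {s : ℂ} {p : ℝ × ℝ}
    (hp : p ∈ exceptionalPoints s) : Tendsto (fun q : ℝ × ℝ => lerchZeta s q.1 q.2)
      (𝓝[openSquare] p) (𝓝 (extLerchZeta s p.1 p.2 + 1)) := by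
  obtain ⟨a, c⟩ := p
  obtain ⟨rfl, hc, ha⟩ := hp
  obtain rfl : c = 0 := hc
  exact tendsto_lerchZeta_zero_right ha (by simp)

/-- On the edge `c = 0` the term `c^{-s}` has no limit when `0 ≤ re s` and `s ≠ 0`. -/
theorem not_tendsto_lerchZeta_zero_right {s : ℂ} (hs : 0 ≤ s.re) (hs0 : s ≠ 0) {a : ℝ}
    (ha : a ∈ Ioo 0 1) (L : ℂ) :
    ¬ Tendsto (fun q : ℝ × ℝ => lerchZeta s q.1 q.2) (𝓝[openSquare] (a, 0)) (𝓝 L) := by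
  intro h
  have hpath : Tendsto (fun x : ℝ => (a, x)) (𝓝[>] 0) (𝓝[openSquare] (a, 0)) := by
    refine tendsto_nhdsWithin_iff.mpr ⟨?_, ?_⟩
    · exact ((by fun_prop : Continuous fun x : ℝ => (a, x)).tendsto 0).mono_left
        nhdsWithin_le_nhds
    · filter_upwards [Ioo_mem_nhdsGT (zero_lt_one' ℝ)] with x hx using ⟨ha, hx⟩
  refine not_tendsto_cpow_nhdsGT_zero (w := -s) (by simpa using hs) (neg_ne_zero.mpr hs0) _
    (((h.sub (tendsto_circlePoint_mul_lerchPhi_add_one s ha)).comp hpath).congr' ?_)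
  filter_upwards [Ioo_mem_nhdsGT (zero_lt_one' ℝ)] with x hx
  have := lerchZeta_eq_cpow_add s (q := (a, x)) ⟨ha, hx⟩
  simp only [Function.comp, this, add_sub_cancel_right]

/-- A limit at the point `(a, c)` of a vertical edge, in terms of the continuation: `ε` is the
direction from the edge into the square. -/
theorem exists_norm_lerchPhi_sub_lt {s : ℂ} {a c ε : ℝ} (hε : a = 0 ∧ ε = 1 ∨ a = 1 ∧ ε = -1)
    {L : ℂ} (h : Tendsto (fun q : ℝ × ℝ => lerchZeta s q.1 q.2) (𝓝[openSquare] (a, c)) (𝓝 L))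
    {η : ℝ} (hη : 0 < η) : ∃ δ > 0, δ ≤ 1 ∧ ∀ x ∈ Ioo 0 δ, ∀ c' ∈ Ioo 0 1, |c' - c| < δ →
      ‖lerchPhi s (circlePoint (ε * x)) c' - L‖ < η := by
  obtain ⟨δ, hδ, hδη⟩ := Metric.tendsto_nhdsWithin_nhds.mp h η hη
  refine ⟨min δ 1, lt_min hδ one_pos, min_le_right _ _, fun x hx c' hc' hcc => ?_⟩
  have hx1 : x < 1 := hx.2.trans_le (min_le_right _ _)
  have hmem : a + ε * x ∈ Ioo (0 : ℝ) 1 := by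
    rcases hε with ⟨rfl, rfl⟩ | ⟨rfl, rfl⟩ <;> constructor <;> linarith [hx.1]
  have hcp : circlePoint (a + ε * x) = circlePoint (ε * x) := by
    rcases hε with ⟨rfl, rfl⟩ | ⟨rfl, rfl⟩
    · rw [zero_add]
    · rw [← circlePoint_sub_one, add_sub_cancel_left]
  have hεx : |ε * x| = x := by
    rcases hε with ⟨-, rfl⟩ | ⟨-, rfl⟩ <;> simp [abs_of_pos hx.1]
  have h1 := hδη (x := (a + ε * x, c')) ⟨hmem, hc'⟩ (by
    rw [Prod.dist_eq, max_lt_iff, Real.dist_eq, Real.dist_eq, add_sub_cancel_left, hεx]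
    exact ⟨hx.2.trans_le (min_le_left _ _), hcc.trans_le (min_le_left _ _)⟩)
  rwa [dist_eq_norm, lerchZeta_eq_lerchPhi hmem hc'.1, hcp] at h1

/-- On the closed vertical edges without their lower end points there is no limit unless
`1 < re s`: it would pass to the horizontal line at the height of the point. -/
theorem not_tendsto_lerchZeta_vertical {s : ℂ} (hs : s.re ≤ 1) {a c ε : ℝ}
    (hε : a = 0 ∧ ε = 1 ∨ a = 1 ∧ ε = -1) (hc : 0 < c) (hc1 : c ≤ 1) (L : ℂ) :
    ¬ Tendsto (fun q : ℝ × ℝ => lerchZeta s q.1 q.2) (𝓝[openSquare] (a, c)) (𝓝 L) := by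
  intro h
  have hε' : ε = 1 ∨ ε = -1 := hε.imp And.right And.right
  refine not_tendsto_lerchPhi hs hc hε' L (Metric.tendsto_nhds.mpr fun η hη => ?_)
  obtain ⟨δ, hδ, hδ1, hb⟩ := exists_norm_lerchPhi_sub_lt hε h (half_pos hη)
  filter_upwards [Ioo_mem_nhdsGT hδ] with x hx
  rw [dist_eq_norm]
  -- For `c = 1` the horizontal line through `(a, c)` misses the square, so `c` is approached
  -- from inside it.
  have hz := circlePoint_mul_ne_one hε' ⟨hx.1, hx.2.trans_le hδ1⟩
  have hcont : Tendsto (fun c' => ‖lerchPhi s (circlePoint (ε * x)) c' - L‖) (𝓝[Ioo 0 1] c)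
      (𝓝 ‖lerchPhi s (circlePoint (ε * x)) c - L‖) := by
    have h1 : ContinuousOn (fun c' => lerchPhi s (circlePoint (ε * x)) c') (Ioi 0) :=
      continuousOn_lerchPhi.comp (f := fun c' : ℝ => (s, circlePoint (ε * x), c'))
        (by fun_prop) fun c' hc' => ⟨(norm_circlePoint _).le, hz, hc'⟩
    exact (((h1 c hc).mono Ioo_subset_Ioi_self).tendsto.sub_const L).norm
  have hne : (𝓝[Ioo (0 : ℝ) 1] c).NeBot := by
    rw [← mem_closure_iff_nhdsWithin_neBot, closure_Ioo zero_ne_one]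
    exact ⟨hc.le, hc1⟩
  refine (le_of_tendsto hcont ?_).trans_lt (half_lt_self hη)
  filter_upwards [self_mem_nhdsWithin, mem_nhdsWithin_of_mem_nhds (Metric.ball_mem_nhds c hδ)]
    with c' hc' hcc
  exact (hb x hx c' hc' hcc).le

/-- At the corners with `c = 0`, the function is unbounded along `a → a₀` for `re s ≤ 0`, and along
`c → 0` for `re s > 0`. -/
theorem not_tendsto_lerchZeta_lower_corner {s : ℂ} {a ε : ℝ}
    (hε : a = 0 ∧ ε = 1 ∨ a = 1 ∧ ε = -1) (L : ℂ) :
    ¬ Tendsto (fun q : ℝ × ℝ => lerchZeta s q.1 q.2) (𝓝[openSquare] (a, 0)) (𝓝 L) := by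
  intro h
  have hε' : ε = 1 ∨ ε = -1 := hε.imp And.right And.right
  obtain ⟨δ, hδ, hδ1, hb⟩ := exists_norm_lerchPhi_sub_lt hε h one_pos
  have hb' : ∀ x ∈ Ioo 0 δ, ∀ c ∈ Ioo 0 δ, ‖lerchPhi s (circlePoint (ε * x)) c‖ ≤ ‖L‖ + 1 := by
    intro x hx c hc
    have h1 := hb x hx c ⟨hc.1, hc.2.trans_le hδ1⟩ (by rw [sub_zero, abs_of_pos hc.1]; exact hc.2)
    linarith [norm_le_norm_add_norm_sub' (lerchPhi s (circlePoint (ε * x)) c) L]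
  have hδ2 : δ / 2 ∈ Ioo 0 δ := ⟨half_pos hδ, half_lt_self hδ⟩
  rcases le_or_gt s.re 0 with hs | hs
  · refine not_eventually_norm_lerchPhi_le hs hδ2.1 hε' (‖L‖ + 1) ?_
    filter_upwards [Ioo_mem_nhdsGT hδ] with x hx using hb' x hx _ hδ2
  · set z := circlePoint (ε * (δ / 2))
    have hz : ‖z‖ ≤ 1 := (norm_circlePoint _).le
    have hz1 : z ≠ 1 := circlePoint_mul_ne_one hε' ⟨hδ2.1, hδ2.2.trans_le hδ1⟩
    have h1 : Tendsto (fun c : ℝ => ‖z * lerchPhi s z (c + 1)‖) (𝓝[>] 0)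
        (𝓝 ‖z * lerchPhi s z (0 + 1)‖) := by
      have hcont : ContinuousOn (fun c : ℝ => lerchPhi s z (c + 1)) (Ioi (-1)) :=
        continuousOn_lerchPhi.comp (f := fun c : ℝ => (s, z, c + 1)) (by fun_prop)
          fun c hc => ⟨hz, hz1, by rw [mem_Ioi] at hc; linarith⟩
      have h0 : ContinuousAt (fun c : ℝ => lerchPhi s z (c + 1)) 0 :=
        hcont.continuousAt (Ioi_mem_nhds (by norm_num))
      exact ((h0.tendsto.const_mul z).norm).mono_left nhdsWithin_le_nhds
    have h2 : Tendsto (fun c : ℝ => c ^ (-s.re)) (𝓝[>] 0) atTop :=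
      tendsto_rpow_neg_nhdsGT_zero (neg_lt_zero.mpr hs)
    have h3 := (h2.eventually_gt_atTop (‖L‖ + 1 + (‖z * lerchPhi s z (0 + 1)‖ + 1))).and
      ((h1.eventually_le_const (lt_add_one _)).and (Ioo_mem_nhdsGT hδ))
    obtain ⟨c, hc1, hc2, hc⟩ := h3.exists
    have h4 := lerchPhi_eq_cpow_add hz hz1 hc.1 s
    have h5 : c ^ (-s.re) = ‖lerchPhi s z c - z * lerchPhi s z (c + 1)‖ := by
      rw [h4, add_sub_cancel_right, Complex.norm_cpow_eq_rpow_re_of_pos hc.1, Complex.neg_re]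
    linarith [norm_sub_le (lerchPhi s z c) (z * lerchPhi s z (c + 1)), hb' _ hδ2 c hc]

theorem mem_of_tendsto_lerchZeta {s : ℂ} {p : ℝ × ℝ} (hp : p ∈ frontier openSquare) {L : ℂ}
    (h : Tendsto (fun q : ℝ × ℝ => lerchZeta s q.1 q.2) (𝓝[openSquare] p) (𝓝 L)) :
    p ∈ extensionPoints s ∪ exceptionalPoints s := by
  obtain ⟨⟨ha, hc⟩, hnot⟩ := mem_frontier_openSquare hp
  obtain ⟨a, c⟩ := p
  dsimp only at ha hc
  by_cases hai : a ∈ Ioo (0 : ℝ) 1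
  · rcases hc.1.eq_or_lt with rfl | hc0
    · rcases lt_or_ge s.re 0 with hs | hs
      · exact Or.inl (Or.inr (Or.inr (Or.inl ⟨rfl, hai, hs⟩)))
      · by_cases hs0 : s = 0
        · exact Or.inr ⟨hs0, rfl, hai⟩
        · exact absurd h (not_tendsto_lerchZeta_zero_right hs hs0 hai L)
    · rcases hc.2.eq_or_lt with rfl | hc1
      · exact Or.inl (Or.inr (Or.inr (Or.inr (Or.inl ⟨rfl, hai⟩))))
      · exact absurd ⟨hai, hc0, hc1⟩ hnot
  · have hε : ∃ ε : ℝ, a = 0 ∧ ε = 1 ∨ a = 1 ∧ ε = -1 := by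
      rcases ha.1.eq_or_lt with h0 | h0
      · exact ⟨1, Or.inl ⟨h0.symm, rfl⟩⟩
      · rcases ha.2.eq_or_lt with h1 | h1
        · exact ⟨-1, Or.inr ⟨h1, rfl⟩⟩
        · exact absurd ⟨h0, h1⟩ hai
    obtain ⟨ε, hε⟩ := hε
    rcases hc.1.eq_or_lt with rfl | hc0
    · exact absurd h (not_tendsto_lerchZeta_lower_corner hε L)
    · rcases le_or_gt s.re 1 with hs | hs
      · exact absurd h (not_tendsto_lerchZeta_vertical hs hε hc0 hc.2 L)
      · left
        rcases hc.2.eq_or_lt with rfl | hc1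
        · refine Or.inr (Or.inr (Or.inr (Or.inr ⟨?_, hs⟩)))
          exact hε.imp (fun h => by rw [h.1]) fun h => by rw [h.1]
        · rcases hε with ⟨h0, -⟩ | ⟨h1, -⟩
          · exact Or.inl ⟨h0, ⟨hc0, hc1⟩, hs⟩
          · exact Or.inr (Or.inl ⟨h1, ⟨hc0, hc1⟩, hs⟩)

/-! ### Continuous extension to the boundary -/

theorem IsContinuousExtension.tendsto {s : ℂ} {T : Set (ℝ × ℝ)} {g : ℝ × ℝ → ℂ}
    (hg : IsContinuousExtension s T g) {p : ℝ × ℝ} (hp : p ∈ T) :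
    Tendsto (fun q : ℝ × ℝ => lerchZeta s q.1 q.2) (𝓝[openSquare] p) (𝓝 (g p)) := by
  refine ((hg.1 p (Or.inr hp)).mono subset_union_left).tendsto.congr' ?_
  filter_upwards [self_mem_nhdsWithin] with q hq using hg.2 q hq

theorem extLerchZeta_eq_lerchZeta {s : ℂ} {p : ℝ × ℝ} (hp : p ∈ openSquare) :
    extLerchZeta s p.1 p.2 = lerchZeta s p.1 p.2 := by
  rw [extLerchZeta_eq_lerchPhi hp.1 hp.2.1 hp.2.2.le, lerchZeta_eq_lerchPhi hp.1 hp.2.1]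

/-- A function on the square and `T` is a continuous extension as soon as its values on `T` are the
limits from within the square. -/
theorem isContinuousExtension_of_tendsto {s : ℂ} {T : Set (ℝ × ℝ)} (hT : T ⊆ frontier openSquare)
    {g : ℝ × ℝ → ℂ} (hg : ∀ p ∈ openSquare, g p = lerchZeta s p.1 p.2)
    (h : ∀ p ∈ T, Tendsto (fun q : ℝ × ℝ => lerchZeta s q.1 q.2) (𝓝[openSquare] p) (𝓝 (g p))) :
    IsContinuousExtension s T g := by
  have hlim : ∀ p ∈ openSquare ∪ T,
      Tendsto (fun q : ℝ × ℝ => lerchZeta s q.1 q.2) (𝓝[openSquare] p) (𝓝 (g p)) := by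
    rintro p (hp | hp)
    · rw [hg p hp, ← extLerchZeta_eq_lerchZeta hp]
      exact tendsto_lerchZeta_of_pos_right s hp.1 hp.2.1 hp.2.2.le
    · exact h p hp
  have hsub : openSquare ∪ T ⊆ closure openSquare :=
    union_subset subset_closure (hT.trans frontier_subset_closure)
  refine ⟨(continuousOn_extendFrom hsub fun p hp => ⟨_, hlim p hp⟩).congr fun p hp => ?_, hg⟩
  exact (extendFrom_eq (hsub hp) (hlim p hp)).symm

theorem mainTheorem3 (s : ℂ) (T : Set (ℝ × ℝ)) (hT : T ⊆ frontier openSquare) :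
    ((∃ g : ℝ × ℝ → ℂ, IsContinuousExtension s T g) ↔
      T ⊆ extensionPoints s ∪ exceptionalPoints s) ∧
    (∀ g : ℝ × ℝ → ℂ, IsContinuousExtension s T g →
      (∀ p ∈ T ∩ extensionPoints s, g p = extLerchZeta s p.1 p.2) ∧
      (∀ p ∈ T ∩ exceptionalPoints s, g p = extLerchZeta s p.1 p.2 + 1)) ∧
    (IsContinuousExtension s T (fun p => extLerchZeta s p.1 p.2) ↔ T ⊆ extensionPoints s) := by
  have hne : ∀ p ∈ T, (𝓝[openSquare] p).NeBot := fun p hp =>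
    mem_closure_iff_nhdsWithin_neBot.mp (frontier_subset_closure (hT hp))
  have hmem : ∀ g : ℝ × ℝ → ℂ, IsContinuousExtension s T g →
      T ⊆ extensionPoints s ∪ exceptionalPoints s := fun g hg p hp =>
    mem_of_tendsto_lerchZeta (hT hp) (hg.tendsto hp)
  have hval : ∀ g : ℝ × ℝ → ℂ, IsContinuousExtension s T g →
      (∀ p ∈ T ∩ extensionPoints s, g p = extLerchZeta s p.1 p.2) ∧
      (∀ p ∈ T ∩ exceptionalPoints s, g p = extLerchZeta s p.1 p.2 + 1) := by
    refine fun g hg => ⟨fun p hp => ?_, fun p hp => ?_⟩ <;> have := hne p hp.1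
    · exact tendsto_nhds_unique (hg.tendsto hp.1) (tendsto_lerchZeta_of_mem_extensionPoints hp.2)
    · exact tendsto_nhds_unique (hg.tendsto hp.1)
        (tendsto_lerchZeta_of_mem_exceptionalPoints hp.2)
  refine ⟨⟨fun ⟨g, hg⟩ => hmem g hg, fun hsub => ?_⟩, hval, fun hg p hp => ?_, fun hsub => ?_⟩
  · refine ⟨extendFrom openSquare fun q => lerchZeta s q.1 q.2,
      isContinuousExtension_of_tendsto hT (fun p hp => ?_) fun p hp => ?_⟩
    · refine extendFrom_eq (subset_closure hp) ?_
      rw [← extLerchZeta_eq_lerchZeta hp]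
      exact tendsto_lerchZeta_of_pos_right s hp.1 hp.2.1 hp.2.2.le
    · refine tendsto_extendFrom ?_
      rcases hsub hp with h | h
      · exact ⟨_, tendsto_lerchZeta_of_mem_extensionPoints h⟩
      · exact ⟨_, tendsto_lerchZeta_of_mem_exceptionalPoints h⟩
  · refine (hmem _ hg hp).resolve_right fun h => ?_
    exact one_ne_zero (left_eq_add.mp ((hval _ hg).2 p ⟨hp, h⟩))
  · exact isContinuousExtension_of_tendsto hT (fun p hp => extLerchZeta_eq_lerchZeta hp)
      fun p hp => tendsto_lerchZeta_of_mem_extensionPoints (hsub hp)
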